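/- \textbf{Definitions.} A \emph{temporal graph} $\mathcal G=(V,E)$ consists of a finite vertex set $V$ and a finite set $E$ of \emph{time arcs} $(v,w,t,\lambda)$ with start vertex $v\in V$, end vertex $w\in V$, time label $t\in\mathbb N$ and traversal time $\lambda\in\mathbb N$ (where $0\in\mathbb N$). Let $\delta\in\mathbb N$ and $D\subseteq E$. A \emph{$D$-delayed temporal path} from $s$ to $z$ is a sequence of time arcs $e_i=(v_i,w_i,t_i,\lambda_i)\in E$, $1\le i\le\ell$, such that $v_1=s$, $w_\ell=z$, and for all $i<\ell$ both $w_i=v_{i+1}$ and $t_i+\lambda_i+\delta\,[e_i\in D]\le t_{i+1}$ hold, and such that the vertices $s,w_1,\dots,w_\ell$ are pairwise distinct; the empty sequence is such a path if $s=z$. \textsc{Delay-Robust Connection} is the following decision problem. Input: a temporal graph $\mathcal G=(V,E)$, vertices $s,z\in V$, and $x,\delta\in\mathbb N$. Question: is there, for every $D\subseteq E$ with $|D|\le x$, a $D$-delayed temporal path from $s$ to $z$ in $\mathcal G$? \textbf{Theorem.} \textsc{Delay-Robust Connection} can be solved in $O(|E|^2)$ time. That is, there are a single word RAM program and absolute constants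 $C,k\in\mathbb N$ such that, on every instance, the program halts with the correct answer after at most $C\,(|E|^2+1)$ steps. Here $V=\{0,\dots,|V|-1\}$, and the input, placed in consecutive memory cells (all other cells and all registers being $0$), consists of the numbers $|V|,|E|,s,z,x,\delta$ followed by the four entries of each time arc, the time arcs being listed without repetition in an arbitrary order. The machine has registers and a random access memory, and constants, register and memory accesses, additions, subtractions truncated at $0$, and tests whether a value is $0$ take one step each. The program never produces a number $\ge (B+2)^k$, where $B$ is any bound on the number of input words and on their values; so words of $O(\log (B+2))$ bits suffice. -/

import Mathlib

/-! ### Temporal graphs and delayed temporal paths -/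

/-- A time arc `(v, w, t, lam)`: start vertex, end vertex, time label, traversal time. -/
structure TimeArc (V : Type*) where
  src : V
  dst : V
  time : ℕ
  trav : ℕ
deriving DecidableEq

/-- A temporal graph on the vertex set `V`: a finite set of time arcs. -/
structure TemporalGraph (V : Type*) where
  arcs : Finset (TimeArc V)

/-- Arrival time of `e` when exactly the arcs in `D` are delayed, i.e. have their traversal time
increased by `δ`. -/
def delayedArrival {V : Type*} [DecidableEq V] (δ : ℕ) (D : Finset (TimeArc V))
    (e : TimeArc V) : ℕ :=
  e.time + (e.trav + if e ∈ D then δ else 0)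

/-- `p` is a `D`-delayed temporal walk from `s` to `z` in `G`: a sequence of time arcs of `G` that
starts at `s`, ends at `z`, and in which every arc starts where, and not before, the previous
(possibly delayed) one arrives. The empty sequence is a walk from a vertex to itself. -/
structure IsDelayedTemporalWalk {V : Type*} [DecidableEq V] (G : TemporalGraph V) (δ : ℕ)
    (D : Finset (TimeArc V)) (s z : V) (p : List (TimeArc V)) : Prop where
  mem_arcs : ∀ e ∈ p, e ∈ G.arcs
  start : ∀ e ∈ p.head?, e.src = s
  finish : (p.getLast?.map TimeArc.dst).getD s = z
  chain : p.IsChain fun e f => e.dst = f.src ∧ delayedArrival δ D e ≤ f.time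

/-- A `D`-delayed temporal path from `s` to `z`: a walk that visits no vertex twice. -/
structure IsDelayedTemporalPath {V : Type*} [DecidableEq V] (G : TemporalGraph V) (δ : ℕ)
    (D : Finset (TimeArc V)) (s z : V) (p : List (TimeArc V)) : Prop extends
    IsDelayedTemporalWalk G δ D s z p where
  nodup : (s :: p.map TimeArc.dst).Nodup

/-! ### The decision problem Delay-Robust Connection -/

/-- An instance: a temporal graph with vertex set `{0, …, n - 1}`, two vertices `s`, `z`, the
bound `x` on the number of delays and the length `δ` of a delay. -/
structure DRCInstance where
  n : ℕ
  graph : TemporalGraph (Fin n)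
  s : Fin n
  z : Fin n
  x : ℕ
  δ : ℕ

/-- Yes-instances: for every set `D` of at most `x` time arcs there is a `D`-delayed temporal
path from `s` to `z`. -/
def DRCInstance.IsYes (I : DRCInstance) : Prop :=
  ∀ D : Finset (TimeArc (Fin I.n)), D ⊆ I.graph.arcs → D.card ≤ I.x →
    ∃ p, IsDelayedTemporalPath I.graph I.δ D I.s I.z p

/-- The four words `v, w, t, lam` that encode a time arc. -/
def TimeArc.encode {n : ℕ} (e : TimeArc (Fin n)) : List ℕ :=
  [(e.src : ℕ), (e.dst : ℕ), e.time, e.trav]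

/-- `w` is an encoding of the instance `I`: the words `|V|, |E|, s, z, x, δ`, followed by four
words for each time arc, the time arcs being listed without repetition in an arbitrary order. -/
def DRCInstance.IsEncoding (I : DRCInstance) (w : List ℕ) : Prop :=
  ∃ L : List (TimeArc (Fin I.n)), L.Nodup ∧ L.toFinset = I.graph.arcs ∧
    w = [I.n, I.graph.arcs.card, (I.s : ℕ), (I.z : ℕ), I.x, I.δ] ++ L.flatMap TimeArc.encode

/-! ### Word RAM programs and their running time -/

namespace WordRAM

/-- A state of the machine: registers, and a random access memory. -/
structure State where
  reg : ℕ → ℕ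
  mem : ℕ → ℕ

/-- Expressions: constants, registers, memory access (the address is the value of an expression),
addition, and subtraction truncated at `0`. -/
inductive Expr where
  | lit (c : ℕ)
  | reg (r : ℕ)
  | load (a : Expr)
  | add (a b : Expr)
  | sub (a b : Expr)

namespace Expr

def eval (σ : State) : Expr → ℕ
  | lit c => c
  | reg r => σ.reg r
  | load a => σ.mem (a.eval σ)
  | add a b => a.eval σ + b.eval σ
  | sub a b => a.eval σ - b.eval σ

/-- The cost of evaluating an expression: one step for each operation and each operand. -/
def cost : Expr → ℕ
  | lit _ => 1
  | reg _ => 1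
  | load a => a.cost + 1
  | add a b => a.cost + b.cost + 1
  | sub a b => a.cost + b.cost + 1

/-- All values that occur in the evaluation of the expression (memory addresses included) fit
into a machine word, i.e. are less than `W`. -/
def Fits (W : ℕ) (σ : State) : Expr → Prop
  | lit c => c < W
  | reg r => σ.reg r < W
  | load a => a.Fits W σ ∧ σ.mem (a.eval σ) < W
  | add a b => a.Fits W σ ∧ b.Fits W σ ∧ a.eval σ + b.eval σ < W
  | sub a b => a.Fits W σ ∧ b.Fits W σ

end Expr

/-- Programs: assignment of the value of an expression to a register, `store a e` (write the value
of `e` into the memory cell with address `a`), composition, branching and loops; the tests are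
of the form `e ≠ 0`. -/
inductive Prog where
  | skip
  | assign (r : ℕ) (e : Expr)
  | store (a e : Expr)
  | seq (P Q : Prog)
  | ite (e : Expr) (P Q : Prog)
  | while (e : Expr) (P : Prog)

/-- `Exec W P σ τ t`: on a machine whose words hold the numbers less than `W`, the program `P`
started in the state `σ` halts in the state `τ` after `t` steps, without ever producing a number
that does not fit into a word. -/
inductive Exec (W : ℕ) : Prog → State → State → ℕ → Prop
  | skip (σ : State) : Exec W Prog.skip σ σ 1
  | assign (r : ℕ) (e : Expr) (σ : State) (he : e.Fits W σ) :
      Exec W (Prog.assign r e) σ ⟨Function.update σ.reg r (e.eval σ), σ.mem⟩ (e.cost + 1)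
  | store (a e : Expr) (σ : State) (ha : a.Fits W σ) (he : e.Fits W σ) :
      Exec W (Prog.store a e) σ ⟨σ.reg, Function.update σ.mem (a.eval σ) (e.eval σ)⟩
        (a.cost + e.cost + 1)
  | seq {P Q : Prog} {σ τ υ : State} {t u : ℕ} (hP : Exec W P σ τ t) (hQ : Exec W Q τ υ u) :
      Exec W (Prog.seq P Q) σ υ (t + u)
  | iteTrue {e : Expr} {P Q : Prog} {σ τ : State} {t : ℕ} (he : e.Fits W σ)
      (hc : e.eval σ ≠ 0) (hP : Exec W P σ τ t) :
      Exec W (Prog.ite e P Q) σ τ (e.cost + 1 + t)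
  | iteFalse {e : Expr} {P Q : Prog} {σ τ : State} {t : ℕ} (he : e.Fits W σ)
      (hc : e.eval σ = 0) (hQ : Exec W Q σ τ t) :
      Exec W (Prog.ite e P Q) σ τ (e.cost + 1 + t)
  | whileTrue {e : Expr} {P : Prog} {σ τ υ : State} {t u : ℕ} (he : e.Fits W σ)
      (hc : e.eval σ ≠ 0) (hP : Exec W P σ τ t) (hW : Exec W (Prog.while e P) τ υ u) :
      Exec W (Prog.while e P) σ υ (e.cost + 1 + t + u)
  | whileFalse {e : Expr} {P : Prog} {σ : State} (he : e.Fits W σ) (hc : e.eval σ = 0) :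
      Exec W (Prog.while e P) σ σ (e.cost + 1)

/-- The initial state: the input `w` is in the memory cells `0, …, w.length - 1`, and everything
else is `0`. -/
def init (w : List ℕ) : State := ⟨fun _ => 0, fun i => w.getD i 0⟩

/-- The decision problem with instances `α`, encodings `enc` and yes-instances `yes` is solved in
time `T` by the program `P` with words of `k * log (B + 2)` bits, where `B` is any bound on the
length and on the entries of the input: on every encoding of every instance, `P` halts after at
most `T` steps with the answer (`1` for yes, `0` for no) in register `0`. -/
def Solves {α : Type*} (enc : α → List ℕ → Prop) (yes : α → Prop) (T : α → ℕ) (k : ℕ)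
    (P : Prog) : Prop :=
  ∀ (I : α) (w : List ℕ), enc I w → ∀ B : ℕ, w.length ≤ B → (∀ a ∈ w, a ≤ B) →
    ∃ (τ : State) (t : ℕ), Exec ((B + 2) ^ k) P (init w) τ t ∧ t ≤ T I ∧
      (yes I → τ.reg 0 = 1) ∧ (¬ yes I → τ.reg 0 = 0)

end WordRAM

/-! The question is a minimum cut problem. The network has a source at `s` with time 0 and, for
every time arc, three events: its departure, its punctual arrival and its delayed arrival. Each
event has a waiting edge to the next event at the same vertex. Each departure has an edge of
capacity 1 to the punctual arrival and an edge to the delayed arrival. With `m = |E|`, waiting edges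
and edges to delayed arrivals have capacity `m + 1`, so no cut of capacity at most `m` contains
them.

Cuts and delays correspond. If delaying `D` separates `s` from `z`, the events reachable under `D`
are closed under waiting and under delayed arrivals, and leave only through the unit edges of arcs
in `D`; this cut has capacity at most `|D|` (`exists_cut_of_not_isYes`). Conversely, a cut `S` of
capacity at most `min x m` contains only unit edges. When their arcs are delayed, a temporal walk
from `s` never leaves `S`, hence misses `z` (`not_isYes_of_cut`). Walks suffice, since under
unlimited waiting a walk can be shortened to a path (`Arrives.exists_path`). So the answer is yes
exactly if every cut has capacity at least `min x m + 1`.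

This is tested by at most `min x m + 1 ≤ m + 1` augmentations, each with a linear-time breadth-first
search (`maxFlow_spec`). No flow is ever defined: an augmentation lowers the residual capacity of
every cut by exactly 1 (`augment_spec`), and a failed search yields a cut of residual capacity 0.
The waiting edges are found by comparing all pairs of events, so both phases take `O(m ^ 2)` steps.
-/

namespace WordRAM

/-! ### Verification of programs -/

/-- All registers and all memory cells hold numbers at most `b`. -/
def Bounded (b : ℕ) (σ : State) : Prop :=
  (∀ r, σ.reg r ≤ b) ∧ ∀ a, σ.mem a ≤ b

/-- The largest constant of an expression. -/
def Expr.maxLit : Expr → ℕ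
  | .lit c => c
  | .reg _ => 0
  | .load a => a.maxLit
  | .add a b => max a.maxLit b.maxLit
  | .sub a b => max a.maxLit b.maxLit

/-- Only addition can exceed `b`, and it adds the costs as well. Subexpressions have smaller cost,
so one inequality covers all intermediate values. -/
theorem Expr.eval_le_and_fits {W b : ℕ} {σ : State} (hσ : Bounded b σ) :
    ∀ e : Expr, e.maxLit ≤ b →
      e.eval σ ≤ e.cost * b ∧ (e.cost * b < W → e.Fits W σ) := by
  intro e
  induction e with
  | lit c =>
    intro h
    simp only [maxLit] at h
    simp only [eval, cost, Fits, one_mul]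
    exact ⟨h, fun h' => lt_of_le_of_lt h h'⟩
  | reg r =>
    intro h
    simp only [eval, cost, Fits, one_mul]
    exact ⟨hσ.1 r, fun h' => lt_of_le_of_lt (hσ.1 r) h'⟩
  | load a ih =>
    intro h
    obtain ⟨h1, h2⟩ := ih h
    simp only [eval, cost, Fits, add_mul, one_mul]
    have := hσ.2 (a.eval σ)
    exact ⟨by omega, fun h' => ⟨h2 (by omega), by omega⟩⟩
  | add a c iha ihc =>
    intro h
    simp only [maxLit, max_le_iff] at h
    obtain ⟨h1, h2⟩ := iha h.1
    obtain ⟨h3, h4⟩ := ihc h.2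
    simp only [eval, cost, Fits, add_mul, one_mul]
    exact ⟨by omega, fun h' => ⟨h2 (by omega), h4 (by omega), by omega⟩⟩
  | sub a c iha ihc =>
    intro h
    simp only [maxLit, max_le_iff] at h
    obtain ⟨h1, h2⟩ := iha h.1
    obtain ⟨h3, h4⟩ := ihc h.2
    simp only [eval, cost, Fits, add_mul, one_mul]
    exact ⟨by omega, fun h' => ⟨h2 (by omega), h4 (by omega)⟩⟩

/-- The expression has size at most `100`, and its constants are at most `100`. -/
def Expr.Small (e : Expr) : Prop := e.cost ≤ 100 ∧ e.maxLit ≤ 100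

instance (e : Expr) : Decidable e.Small := inferInstanceAs (Decidable (_ ∧ _))

/-- All expressions of a program are small. -/
def Prog.Small : Prog → Prop
  | .skip => True
  | .assign _ e => e.Small
  | .store a e => a.Small ∧ e.Small
  | .seq P Q => P.Small ∧ Q.Small
  | .ite e P Q => e.Small ∧ P.Small ∧ Q.Small
  | .while e P => e.Small ∧ P.Small

instance Prog.decidableSmall : ∀ P : Prog, Decidable P.Small
  | .skip => isTrue trivial
  | .assign _ e => inferInstanceAs (Decidable e.Small)
  | .store a e => inferInstanceAs (Decidable (a.Small ∧ e.Small))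
  | .seq P Q =>
    have := P.decidableSmall
    have := Q.decidableSmall
    inferInstanceAs (Decidable (P.Small ∧ Q.Small))
  | .ite e P Q =>
    have := P.decidableSmall
    have := Q.decidableSmall
    inferInstanceAs (Decidable (e.Small ∧ P.Small ∧ Q.Small))
  | .while e P =>
    have := P.decidableSmall
    inferInstanceAs (Decidable (e.Small ∧ P.Small))

/-- Upper bound for the running time of a program without loops. -/
def Prog.cost : Prog → ℕ
  | .skip => 1
  | .assign _ e => e.cost + 1
  | .store a e => a.cost + e.cost + 1
  | .seq P Q => P.cost + Q.cost
  | .ite e P Q => e.cost + 1 + (P.cost + Q.cost)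
  -- A junk value: `wp` is `False` on loops, so this case is never used.
  | .while _ _ => 0

/-- A bound `b` on the contents of the machine and a word size `W` such that the evaluation of
small expressions does not overflow. -/
structure Sizes (W b : ℕ) : Prop where
  le_bound : 100 ≤ b
  lt_word : 100 * b < W

theorem Sizes.fits {W b : ℕ} (hs : Sizes W b) {σ : State} (hσ : Bounded b σ) {e : Expr}
    (he : e.Small) : e.Fits W σ :=
  (Expr.eval_le_and_fits hσ e (he.2.trans hs.le_bound)).2
    (lt_of_le_of_lt (Nat.mul_le_mul_right b he.1) hs.lt_word)

/-- Started in `σ`, the program `P` halts after at most `T` steps in a state with contents bounded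
by `b` that satisfies `Q`. -/
def Run (W b : ℕ) (P : Prog) (T : ℕ) (σ : State) (Q : State → Prop) : Prop :=
  ∃ (τ : State) (t : ℕ), Exec W P σ τ t ∧ t ≤ T ∧ Bounded b τ ∧ Q τ

/-- Weakest precondition of a program without loops. -/
def wp (b : ℕ) : Prog → (State → Prop) → State → Prop
  | .skip, Q, σ => Q σ
  | .assign r e, Q, σ => e.eval σ ≤ b ∧ Q ⟨Function.update σ.reg r (e.eval σ), σ.mem⟩
  | .store a e, Q, σ =>
    e.eval σ ≤ b ∧ Q ⟨σ.reg, Function.update σ.mem (a.eval σ) (e.eval σ)⟩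
  | .seq P P', Q, σ => wp b P (wp b P' Q) σ
  | .ite e P P', Q, σ => (e.eval σ ≠ 0 → wp b P Q σ) ∧ (e.eval σ = 0 → wp b P' Q σ)
  | .while _ _, _, _ => False

theorem Run.mono {W b T T' : ℕ} {P : Prog} {σ : State} {Q Q' : State → Prop}
    (h : Run W b P T σ Q) (hT : T ≤ T') (hQ : ∀ τ, Bounded b τ → Q τ → Q' τ) :
    Run W b P T' σ Q' := by
  obtain ⟨τ, t, h1, h2, h3, h4⟩ := h
  exact ⟨τ, t, h1, h2.trans hT, h3, hQ τ h3 h4⟩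

theorem Run.seq {W b T T' : ℕ} {P P' : Prog} {σ : State} {R Q : State → Prop}
    (h : Run W b P T σ R) (h' : ∀ τ, Bounded b τ → R τ → Run W b P' T' τ Q) :
    Run W b (.seq P P') (T + T') σ Q := by
  obtain ⟨τ, t, h1, h2, h3, h4⟩ := h
  obtain ⟨υ, u, h5, h6, h7, h8⟩ := h' τ h3 h4
  exact ⟨υ, t + u, .seq h1 h5, by omega, h7, h8⟩

theorem Run.ite {W b T T' : ℕ} (hs : Sizes W b) {e : Expr} {P P' : Prog} {σ : State}
    {Q : State → Prop} (hσ : Bounded b σ) (he : e.Small)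
    (h : e.eval σ ≠ 0 → Run W b P T σ Q) (h' : e.eval σ = 0 → Run W b P' T' σ Q) :
    Run W b (.ite e P P') (e.cost + 1 + (T + T')) σ Q := by
  by_cases hc : e.eval σ = 0
  · obtain ⟨τ, t, h1, h2, h3, h4⟩ := h' hc
    exact ⟨τ, _, .iteFalse (hs.fits hσ he) hc h1, by omega, h3, h4⟩
  · obtain ⟨τ, t, h1, h2, h3, h4⟩ := h hc
    exact ⟨τ, _, .iteTrue (hs.fits hσ he) hc h1, by omega, h3, h4⟩

theorem Bounded.assign {b : ℕ} {σ : State} (hσ : Bounded b σ) {r x : ℕ} (hx : x ≤ b) :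
    Bounded b ⟨Function.update σ.reg r x, σ.mem⟩ := by
  refine ⟨fun r' => ?_, hσ.2⟩
  by_cases h : r' = r
  · subst h; simpa using hx
  · simpa [h] using hσ.1 r'

theorem Bounded.store {b : ℕ} {σ : State} (hσ : Bounded b σ) {a x : ℕ} (hx : x ≤ b) :
    Bounded b ⟨σ.reg, Function.update σ.mem a x⟩ := by
  refine ⟨hσ.1, fun a' => ?_⟩
  by_cases h : a' = a
  · subst h; simpa using hx
  · simpa [h] using hσ.2 a'

/-- Reduces loop-free code to symbolic evaluation. Intermediate values are covered by `Sizes.fits`,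
so the only size conditions left in `wp` concern values that are written. -/
theorem Run.of_wp {W b : ℕ} (hs : Sizes W b) {P : Prog} :
    P.Small → ∀ {Q : State → Prop} {σ : State}, Bounded b σ → wp b P Q σ →
      Run W b P P.cost σ Q := by
  induction P with
  | skip => exact fun _ _ σ hσ h => ⟨σ, 1, .skip σ, le_rfl, hσ, h⟩
  | assign r e =>
    exact fun he _ σ hσ h => ⟨_, _, .assign r e σ (hs.fits hσ he), le_rfl, hσ.assign h.1, h.2⟩
  | store a e =>
    exact fun he _ σ hσ h => ⟨_, _, .store a e σ (hs.fits hσ he.1) (hs.fits hσ he.2), le_rfl,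
      hσ.store h.1, h.2⟩
  | seq P P' ih ih' =>
    exact fun hP _ σ hσ h => Run.seq (ih hP.1 hσ h) fun τ hτ h' => ih' hP.2 hτ h'
  | ite e P P' ih ih' =>
    exact fun hP _ σ hσ h => Run.ite hs hσ hP.1 (fun hc => ih hP.2.1 hσ (h.1 hc))
      fun hc => ih' hP.2.2 hσ (h.2 hc)
  | _ => exact fun _ _ _ _ h => h.elim

/-- Loops: `I n` is an invariant under which at most `n` more iterations happen. -/
theorem Run.loop {W b T : ℕ} (hs : Sizes W b) {e : Expr} {P : Prog} (he : e.Small)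
    (I : ℕ → State → Prop)
    (hstep : ∀ n σ, Bounded b σ → I n σ → e.eval σ ≠ 0 → ∃ k, n = k + 1 ∧ Run W b P T σ (I k)) :
    ∀ n σ, Bounded b σ → I n σ →
      Run W b (.while e P) (n * (T + e.cost + 1) + (e.cost + 1)) σ
        fun τ => ∃ k, I k τ ∧ e.eval τ = 0 := by
  intro n
  induction n with
  | zero =>
    intro σ hσ hI
    by_cases hc : e.eval σ = 0
    · exact ⟨σ, _, .whileFalse (hs.fits hσ he) hc, by omega, hσ, 0, hI, hc⟩
    · obtain ⟨k, hk, -⟩ := hstep 0 σ hσ hI hc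
      omega
  | succ n ih =>
    intro σ hσ hI
    by_cases hc : e.eval σ = 0
    · exact ⟨σ, _, .whileFalse (hs.fits hσ he) hc, by omega, hσ, n + 1, hI, hc⟩
    · obtain ⟨k, hk, τ, t, h1, h2, h3, h4⟩ := hstep _ σ hσ hI hc
      obtain rfl : n = k := by omega
      obtain ⟨υ, u, h5, h6, h7, h8⟩ := ih τ h3 h4
      refine ⟨υ, _, .whileTrue (hs.fits hσ he) hc h1 h5, ?_, h7, h8⟩
      rw [add_mul]
      omega

/-! ### Derived expressions -/

/-- Nonzero if and only if the values differ. -/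
def Expr.ne (a b : Expr) : Expr := .add (.sub a b) (.sub b a)

/-- The minimum; as a test, the conjunction. -/
def Expr.inf (a b : Expr) : Expr := .sub a (.sub a b)

/-- The memory cell at a constant offset from an address. -/
def Expr.fld (p : Expr) (k : ℕ) : Expr := .load (.add p (.lit k))

@[simp] theorem Expr.eval_ne (σ : State) (a b : Expr) :
    (Expr.ne a b).eval σ = 0 ↔ a.eval σ = b.eval σ := by
  simp only [Expr.ne, Expr.eval]
  omega

@[simp] theorem Expr.eval_inf (σ : State) (a b : Expr) :
    (Expr.inf a b).eval σ = min (a.eval σ) (b.eval σ) := by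
  simp only [Expr.inf, Expr.eval]
  omega

@[simp] theorem Expr.eval_fld (σ : State) (p : Expr) (k : ℕ) :
    (Expr.fld p k).eval σ = σ.mem (p.eval σ + k) := rfl

/-! ### Residual networks in memory -/

/-- `p` is the address of one of `N` consecutive node records of `16` cells, starting at `p₀`.
The cells `p + j`, `j < 4`, hold the ends of the edges leaving `p` (or `0`), the cells `p + j + 4`
their residual capacities, and the cells `p + j + 8` the addresses of the reverse edges. -/
def IsNode (p₀ N p : ℕ) : Prop := ∃ i < N, p = p₀ + 16 * i

/-- The memory `M` holds a well-formed residual network. -/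
structure Net (p₀ N K : ℕ) (M : ℕ → ℕ) : Prop where
  pos : 0 < p₀
  dvd : p₀ % 16 = 0
  -- A missing edge has end `0` and no capacity, so it can be neither searched nor cut.
  absent : ∀ p, IsNode p₀ N p → ∀ j < 4, M (p + j) = 0 → M (p + j + 4) = 0
  -- Pushing flow preserves the sum of the capacities of an edge and its reverse; the bound `K` on
  -- it keeps all capacities within a word.
  rev : ∀ p, IsNode p₀ N p → ∀ j < 4, M (p + j) ≠ 0 →
    ∃ q, IsNode p₀ N q ∧ ∃ k < 4, M (p + j) = q ∧ M (p + j + 8) = q + k ∧ M (q + k) = p ∧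
      M (q + k + 8) = p + j ∧ q + k ≠ p + j ∧ M (p + j + 4) + M (q + k + 4) ≤ K

open Classical in
/-- The residual capacity of the edges from `S` to its complement. -/
noncomputable def cutCap (p₀ N : ℕ) (M : ℕ → ℕ) (S : Set ℕ) : ℕ :=
  ∑ x ∈ Finset.range N ×ˢ Finset.range 4,
    if p₀ + 16 * x.1 ∈ S ∧ M (p₀ + 16 * x.1 + x.2) ∉ S then M (p₀ + 16 * x.1 + x.2 + 4) else 0

/-- Sending one unit of flow along the edge `e`. -/
def push (M : ℕ → ℕ) (e : ℕ) : ℕ → ℕ :=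
  Function.update (Function.update M (e + 4) (M (e + 4) - 1)) (M (e + 8) + 4)
    (M (M (e + 8) + 4) + 1)

theorem push_apply_of_ne {M : ℕ → ℕ} {e a : ℕ} (h1 : a ≠ e + 4) (h2 : a ≠ M (e + 8) + 4) :
    push M e a = M a := by
  simp [push, h1, h2]

-- The edge loses one unit and its reverse gains one. This matters only if exactly one end lies in
-- `S`: the cut loses 1 if the edge leaves `S` and gains 1 if it enters. The indicators are placed
-- so as to avoid subtraction in `ℕ`.
open Classical in
theorem Net.cutCap_push {p₀ N K : ℕ} {M : ℕ → ℕ} (h : Net p₀ N K M) {p : ℕ}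
    (hp : IsNode p₀ N p) {j : ℕ} (hj : j < 4) (hc : M (p + j + 4) ≠ 0) (S : Set ℕ) :
    cutCap p₀ N (push M (p + j)) S + (if p ∈ S then 1 else 0) =
      cutCap p₀ N M S + if M (p + j) ∈ S then 1 else 0 := by
  have hd : M (p + j) ≠ 0 := fun h0 => hc (h.absent p hp j hj h0)
  obtain ⟨q, ⟨b, hb, rfl⟩, k, hk, h1, h2, h3, h4, h5, -⟩ := h.rev p hp j hj hd
  obtain ⟨a, ha, rfl⟩ := hp
  have hdvd := h.dvd
  have hne : ((b, k) : ℕ × ℕ) ≠ (a, j) := by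
    intro hh
    simp only [Prod.mk.injEq] at hh
    omega
  have hA : (a, j) ∈ Finset.range N ×ˢ Finset.range 4 := by simp [ha, hj]
  have hB : (b, k) ∈ (Finset.range N ×ˢ Finset.range 4).erase (a, j) := by simp [hb, hk, hne]
  unfold cutCap
  -- The terms of the edge and of its reverse are split off; all other terms are unchanged.
  rw [← Finset.add_sum_erase _ _ hA, ← Finset.add_sum_erase _ _ hB,
    ← Finset.add_sum_erase _ _ hA, ← Finset.add_sum_erase _ _ hB]
  have hrest : ∀ x ∈ ((Finset.range N ×ˢ Finset.range 4).erase (a, j)).erase (b, k),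
      (if p₀ + 16 * x.1 ∈ S ∧ push M (p₀ + 16 * a + j) (p₀ + 16 * x.1 + x.2) ∉ S then
        push M (p₀ + 16 * a + j) (p₀ + 16 * x.1 + x.2 + 4) else 0) =
      (if p₀ + 16 * x.1 ∈ S ∧ M (p₀ + 16 * x.1 + x.2) ∉ S then
        M (p₀ + 16 * x.1 + x.2 + 4) else 0) := by
    rintro ⟨c, l⟩ hx
    simp only [Finset.mem_erase, ne_eq, Prod.mk.injEq, Finset.mem_product, Finset.mem_range] at hx
    rw [push_apply_of_ne (by dsimp only; omega) (by dsimp only; omega),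
      push_apply_of_ne (by dsimp only; omega) (by dsimp only; omega)]
  rw [Finset.sum_congr rfl hrest]
  have e1 : push M (p₀ + 16 * a + j) (p₀ + 16 * a + j) = p₀ + 16 * b := by
    rw [push_apply_of_ne (by omega) (by omega), h1]
  have e2 : push M (p₀ + 16 * a + j) (p₀ + 16 * b + k) = p₀ + 16 * a := by
    rw [push_apply_of_ne (by omega) (by omega), h3]
  have e3 : push M (p₀ + 16 * a + j) (p₀ + 16 * a + j + 4) = M (p₀ + 16 * a + j + 4) - 1 := by
    unfold push
    rw [Function.update_of_ne (by omega), Function.update_self]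
  have e4 : push M (p₀ + 16 * a + j) (p₀ + 16 * b + k + 4) = M (p₀ + 16 * b + k + 4) + 1 := by
    unfold push
    rw [h2, Function.update_self]
  simp only [e1, e2, e3, e4, h1, h3]
  by_cases hs : p₀ + 16 * a ∈ S <;> by_cases ht : p₀ + 16 * b ∈ S <;> simp [hs, ht] <;> omega

/-- Only two capacities change, with constant sum. Since reversal is an involution, an edge is one
of the two exactly if its reverse is the other. -/
theorem Net.push {p₀ N K : ℕ} {M : ℕ → ℕ} (h : Net p₀ N K M) {p : ℕ}
    (hp : IsNode p₀ N p) {j : ℕ} (hj : j < 4) (hc : M (p + j + 4) ≠ 0) :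
    Net p₀ N K (push M (p + j)) := by
  have hdvd := h.dvd
  have hpos := h.pos
  have hd : M (p + j) ≠ 0 := fun h0 => hc (h.absent p hp j hj h0)
  obtain ⟨q, ⟨b, hb, rfl⟩, k, hk, h1, h2, h3, h4, h5, h6⟩ := h.rev p hp j hj hd
  obtain ⟨a, ha, rfl⟩ := hp
  have dst : ∀ c, ∀ l < 4, WordRAM.push M (p₀ + 16 * a + j) (p₀ + 16 * c + l) =
      M (p₀ + 16 * c + l) := fun c l hl => push_apply_of_ne (by omega) (by omega)
  have rv : ∀ c, ∀ l < 4, WordRAM.push M (p₀ + 16 * a + j) (p₀ + 16 * c + l + 8) =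
      M (p₀ + 16 * c + l + 8) := fun c l hl => push_apply_of_ne (by omega) (by omega)
  have cp : ∀ c, WordRAM.push M (p₀ + 16 * a + j) (c + 4) =
      if c = p₀ + 16 * b + k then M (p₀ + 16 * b + k + 4) + 1 else
        if c = p₀ + 16 * a + j then M (p₀ + 16 * a + j + 4) - 1 else M (c + 4) := by
    intro c
    unfold WordRAM.push
    rw [h2]
    simp only [Function.update_apply, Nat.add_right_cancel_iff]
  refine ⟨h.pos, hdvd, ?_, ?_⟩
  · rintro _ ⟨c, hcN, rfl⟩ l hl h0
    rw [dst c l hl] at h0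
    have h7 := h.absent _ ⟨c, hcN, rfl⟩ l hl h0
    rw [cp, if_neg, if_neg]
    · exact h7
    · intro h8
      rw [h8] at h0
      exact hd h0
    · intro h8
      rw [h8] at h0
      omega
  · rintro _ ⟨c, hcN, rfl⟩ l hl h0
    rw [dst c l hl] at h0 ⊢
    obtain ⟨_, ⟨d, hdN, rfl⟩, n, hn, g1, g2, g3, g4, g5, g6⟩ := h.rev _ ⟨c, hcN, rfl⟩ l hl h0
    refine ⟨_, ⟨d, hdN, rfl⟩, n, hn, g1, ?_, ?_, ?_, g5, ?_⟩
    · rw [rv c l hl, g2]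
    · rw [dst d n hn, g3]
    · rw [rv d n hn, g4]
    · rw [cp, cp]
      by_cases i1 : p₀ + 16 * c + l = p₀ + 16 * a + j
      · have i2 : p₀ + 16 * d + n = p₀ + 16 * b + k := by rw [← g2, ← h2, i1]
        rw [i1, i2, if_neg (by omega), if_pos rfl, if_pos rfl]
        omega
      · by_cases i2 : p₀ + 16 * c + l = p₀ + 16 * b + k
        · have i3 : p₀ + 16 * d + n = p₀ + 16 * a + j := by rw [← g2, ← h4, i2]
          rw [i2, i3, if_pos rfl, if_neg (by omega), if_pos rfl]
          omega
        · have i3 : p₀ + 16 * d + n ≠ p₀ + 16 * a + j := by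
            intro hh
            rw [hh] at g4
            omega
          have i4 : p₀ + 16 * d + n ≠ p₀ + 16 * b + k := by
            intro hh
            rw [hh] at g4
            omega
          rw [if_neg i2, if_neg i1, if_neg i4, if_neg i3]
          exact g6

/-- Networks that differ only in the scratch fields `p + 12`, `p + 13`, `p + 14`. -/
def SameNet (p₀ : ℕ) (M M' : ℕ → ℕ) : Prop :=
  ∀ a, ¬ (p₀ ≤ a ∧ 12 ≤ a % 16 ∧ a % 16 < 15) → M' a = M a

theorem SameNet.net {p₀ N K : ℕ} {M M' : ℕ → ℕ} (hM : SameNet p₀ M M') (h : Net p₀ N K M) :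
    Net p₀ N K M' := by
  have hdvd := h.dvd
  have e1 : ∀ p, IsNode p₀ N p → ∀ j < 4, M' (p + j) = M (p + j) := by
    rintro _ ⟨a, ha, rfl⟩ j hj
    exact hM _ (by omega)
  have e2 : ∀ p, IsNode p₀ N p → ∀ j < 4, M' (p + j + 4) = M (p + j + 4) := by
    rintro _ ⟨a, ha, rfl⟩ j hj
    exact hM _ (by omega)
  have e3 : ∀ p, IsNode p₀ N p → ∀ j < 4, M' (p + j + 8) = M (p + j + 8) := by
    rintro _ ⟨a, ha, rfl⟩ j hj
    exact hM _ (by omega)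
  refine ⟨h.pos, hdvd, fun p hp j hj => ?_, fun p hp j hj hne => ?_⟩
  · rw [e1 p hp j hj, e2 p hp j hj]
    exact h.absent p hp j hj
  · rw [e1 p hp j hj] at hne
    obtain ⟨q, hq, k, hk, g⟩ := h.rev p hp j hj hne
    refine ⟨q, hq, k, hk, ?_⟩
    rw [e1 p hp j hj, e2 p hp j hj, e3 p hp j hj, e1 q hq k hk, e2 q hq k hk, e3 q hq k hk]
    exact g

theorem SameNet.cutCap {p₀ N : ℕ} {M M' : ℕ → ℕ} (hM : SameNet p₀ M M') (hd : p₀ % 16 = 0)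
    (S : Set ℕ) : cutCap p₀ N M' S = cutCap p₀ N M S := by
  classical
  unfold WordRAM.cutCap
  refine Finset.sum_congr rfl ?_
  rintro ⟨c, l⟩ hx
  simp only [Finset.mem_product, Finset.mem_range] at hx
  rw [hM _ (by dsimp only; omega), hM _ (by dsimp only; omega)]

/-- A cut: it contains the source, but no node of the vertex `z`. -/
structure IsCut (p₀ N z : ℕ) (M : ℕ → ℕ) (S : Set ℕ) : Prop where
  source : p₀ ∈ S
  target : ∀ p, IsNode p₀ N p → p ∈ S → M (p + 15) ≠ z

/-! ### Registers -/

/-- The number of remaining rounds. -/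
local notation "rRounds" => 1
/-- The source of the network. -/
local notation "rSrc" => 2
/-- The position of the head of the queue. -/
local notation "rHead" => 3
/-- The position after the end of the queue. -/
local notation "rTail" => 4
/-- The current node. -/
local notation "rNode" => 5
/-- The node of the target vertex that was found, or `0`. -/
local notation "rFound" => 6
/-- Another node. -/
local notation "rAux" => 7
/-- An edge. -/
local notation "rEdge" => 8

/-! ### Search in the residual network -/

/-- Visit the end of the edge `j` of the current node. -/
def visit (j : ℕ) : Prog :=
  -- The minimum is nonzero if there is residual capacity and the end is unmarked in this round. For
  -- an absent edge the second operand reads an irrelevant cell, but the first is `0`.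
  .ite (.inf (.fld (.reg rNode) (j + 4))
      (.ne (.fld (.fld (.reg rNode) j) 12) (.reg rRounds)))
    (.seq (.assign rAux (.fld (.reg rNode) j)) <|
      .seq (.store (.add (.reg rAux) (.lit 12)) (.reg rRounds)) <|
      .seq (.store (.add (.reg rAux) (.lit 13)) (.add (.reg rNode) (.lit j))) <|
      .seq (.store (.add (.reg rTail) (.lit 14)) (.reg rAux)) <|
      .assign rTail (.add (.reg rTail) (.lit 16)))
    .skip

/-- The state of a breadth-first search: `n` nodes were found, and are listed in the queue;
`h` of them were processed, together with the first `d` edges of the next one. -/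
structure Search (p₀ N q z : ℕ) (M : ℕ → ℕ) (n h d : ℕ) (σ : State) : Prop where
  out : σ.reg 0 = 1
  rounds : σ.reg rRounds = q
  src : σ.reg rSrc = p₀
  tail : σ.reg rTail = p₀ + 16 * n
  same : SameNet p₀ M σ.mem
  pos : 0 < n
  -- The queue is stored across the records: cell 14 of record `i` is the `i`-th queue entry,
  -- unrelated to the node whose record it is.
  first : σ.mem (p₀ + 14) = p₀
  node : ∀ i < n, IsNode p₀ N (σ.mem (p₀ + 16 * i + 14))
  inj : ∀ i < n, ∀ k < n, σ.mem (p₀ + 16 * i + 14) = σ.mem (p₀ + 16 * k + 14) → i = k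
  mark : ∀ p, IsNode p₀ N p → (σ.mem (p + 12) = q ↔ ∃ i < n, σ.mem (p₀ + 16 * i + 14) = p)
  -- Marks are numbers of remaining rounds. These decrease, so old marks are larger than the current
  -- one and need no resetting.
  old : ∀ p, IsNode p₀ N p → σ.mem (p + 12) = 0 ∨ q ≤ σ.mem (p + 12)
  -- Cell 13 holds the edge by which the node was found. The strict decrease of queue positions
  -- makes backtracking terminate.
  parent : ∀ i < n, 0 < i → ∃ k < i, ∃ j < 4,
    σ.mem (σ.mem (p₀ + 16 * i + 14) + 13) = σ.mem (p₀ + 16 * k + 14) + j ∧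
    M (σ.mem (p₀ + 16 * k + 14) + j) = σ.mem (p₀ + 16 * i + 14) ∧
    M (σ.mem (p₀ + 16 * k + 14) + j + 4) ≠ 0
  closed : ∀ i < n, ∀ j < 4, i < h ∨ i = h ∧ j < d → M (σ.mem (p₀ + 16 * i + 14) + j + 4) ≠ 0 →
    ∃ k < n, σ.mem (p₀ + 16 * k + 14) = M (σ.mem (p₀ + 16 * i + 14) + j)
  found : (σ.reg rFound = 0 ∧ ∀ i < n, i < h → M (σ.mem (p₀ + 16 * i + 14) + 15) ≠ z) ∨
    ∃ i < n, σ.reg rFound = σ.mem (p₀ + 16 * i + 14) ∧ M (σ.reg rFound + 15) = z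

/-- The queue entries are distinct nodes. This bounds the number of search steps and keeps the queue
inside the records. -/
theorem Search.card_le {p₀ N q z n h d : ℕ} {M : ℕ → ℕ} {σ : State}
    (hS : Search p₀ N q z M n h d σ) : n ≤ N := by
  have h1 : Finset.card (Finset.image (fun i => σ.mem (p₀ + 16 * i + 14)) (Finset.range n)) = n :=
    (Finset.card_image_of_injOn fun i hi k hk => hS.inj i (by simpa using hi) k
      (by simpa using hk)).trans (Finset.card_range n)
  have h2 : Finset.image (fun i => σ.mem (p₀ + 16 * i + 14)) (Finset.range n) ⊆
      Finset.image (fun i => p₀ + 16 * i) (Finset.range N) := by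
    intro a ha
    simp only [Finset.mem_image, Finset.mem_range] at ha ⊢
    obtain ⟨i, hi, rfl⟩ := ha
    obtain ⟨k, hk, hk'⟩ := hS.node i hi
    exact ⟨k, hk, hk'.symm⟩
  calc n = _ := h1.symm
    _ ≤ _ := Finset.card_le_card h2
    _ ≤ _ := Finset.card_image_le
    _ = N := Finset.card_range N

theorem visit_spec {W b p₀ N K q z n h j : ℕ} {M : ℕ → ℕ} {σ : State} (hs : Sizes W b)
    (hN : Net p₀ N K M) (hb : p₀ + 16 * N + 16 ≤ b) (hj : j < 4) (hσ : Bounded b σ)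
    (hhn : h < n) (hcur : σ.reg rNode = σ.mem (p₀ + 16 * h + 14))
    (hhead : σ.reg rHead = p₀ + 16 * h + 16)
    (hS : Search p₀ N q z M n h j σ) :
    Run W b (visit j) (visit j).cost σ fun τ => ∃ n', n ≤ n' ∧ Search p₀ N q z M n' h (j + 1) τ ∧
      τ.reg rNode = τ.mem (p₀ + 16 * h + 14) ∧ τ.reg rHead = p₀ + 16 * h + 16 := by
  have hnN := hS.card_le
  have hdvd := hN.dvd
  have hpos := hN.pos
  apply Run.of_wp hs (by interval_cases j <;> decide) hσ
  obtain ⟨c, hc, hcp⟩ := hS.node h hhn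
  have hdst : σ.mem (p₀ + 16 * c + j) = M (p₀ + 16 * c + j) := hS.same _ (by omega)
  have hcap : σ.mem (p₀ + 16 * c + j + 4) = M (p₀ + 16 * c + j + 4) := hS.same _ (by omega)
  have hP : σ.reg rNode = p₀ + 16 * c := hcur.trans hcp
  simp only [visit, wp, Expr.eval_inf, Expr.eval_fld, Expr.eval, ne_eq, hP, ← Nat.add_assoc, hdst,
    hcap, hS.tail, hS.rounds, Function.update_apply, reduceIte, Nat.reduceEqDiff]
  have hmin : min (M (p₀ + 16 * c + j + 4))
      (Expr.eval σ ((((Expr.reg rNode).fld j).fld 12).ne (Expr.reg rRounds))) = 0 ↔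
      M (p₀ + 16 * c + j + 4) = 0 ∨ σ.mem (M (p₀ + 16 * c + j) + 12) = q := by
    rw [← hS.rounds, ← hdst]
    have := Expr.eval_ne σ (((Expr.reg rNode).fld j).fld 12) (Expr.reg rRounds)
    simp only [Expr.eval_fld, Expr.eval, hP] at this
    rw [← this]
    omega
  rw [hmin]
  constructor
  · intro hne
    rw [not_or] at hne
    obtain ⟨hne1, hne2⟩ := hne
    obtain ⟨w, hw⟩ : ∃ w, M (p₀ + 16 * c + j) = w := ⟨_, rfl⟩
    rw [hw] at hne2 ⊢
    have hw0 : M (p₀ + 16 * c + j) ≠ 0 := fun h0 => hne1 (hN.absent _ ⟨c, hc, rfl⟩ j hj h0)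
    obtain ⟨_, ⟨e, he, rfl⟩, -, -, hwe, -⟩ := hN.rev _ ⟨c, hc, rfl⟩ j hj hw0
    obtain rfl := hw.symm.trans hwe
    have hq : q ≤ b := hS.rounds ▸ hσ.1 _
    refine ⟨by omega, hq, by omega, by omega, by omega, n + 1, by omega, ?_, ?_, hhead⟩
    · obtain ⟨M', hM'⟩ : ∃ M', M' = Function.update
          (Function.update (Function.update σ.mem (p₀ + 16 * e + 12) q) (p₀ + 16 * e + 13)
            (p₀ + 16 * c + j)) (p₀ + 16 * n + 14) (p₀ + 16 * e) := ⟨_, rfl⟩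
      rw [← hM']
      have hqueue : ∀ i, i ≠ n → M' (p₀ + 16 * i + 14) = σ.mem (p₀ + 16 * i + 14) := by
        intro i hi
        rw [hM', Function.update_of_ne (by omega), Function.update_of_ne (by omega),
          Function.update_of_ne (by omega)]
      have hlast : M' (p₀ + 16 * n + 14) = p₀ + 16 * e := by
        rw [hM', Function.update_self]
      have hmark : ∀ i, i ≠ e → M' (p₀ + 16 * i + 12) = σ.mem (p₀ + 16 * i + 12) := by
        intro i hi
        rw [hM', Function.update_of_ne (by omega), Function.update_of_ne (by omega),
          Function.update_of_ne (by omega)]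
      have hmark' : M' (p₀ + 16 * e + 12) = q := by
        rw [hM', Function.update_of_ne (by omega), Function.update_of_ne (by omega),
          Function.update_self]
      have hpar : ∀ i, i ≠ e → M' (p₀ + 16 * i + 13) = σ.mem (p₀ + 16 * i + 13) := by
        intro i hi
        rw [hM', Function.update_of_ne (by omega), Function.update_of_ne (by omega),
          Function.update_of_ne (by omega)]
      have hpar' : M' (p₀ + 16 * e + 13) = p₀ + 16 * c + j := by
        rw [hM', Function.update_of_ne (by omega), Function.update_self]
      have hnew : ∀ i < n, σ.mem (p₀ + 16 * i + 14) ≠ p₀ + 16 * e := by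
        intro i hi hie
        exact hne2 ((hS.mark _ ⟨e, he, rfl⟩).2 ⟨i, hi, hie⟩)
      have hinto : ∀ a, (∃ k < n, σ.mem (p₀ + 16 * k + 14) = a) →
          ∃ k < n + 1, M' (p₀ + 16 * k + 14) = a := by
        rintro a ⟨k, hk, hka⟩
        exact ⟨k, by omega, by rw [hqueue k (by omega), hka]⟩
      refine ⟨by simpa using hS.out, by simpa using hS.rounds, by simpa using hS.src,
        by simp; ring, ?_, by omega, ?_, ?_, ?_, ?_, ?_, ?_, ?_, ?_⟩
      · intro a ha
        rw [← hS.same a ha]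
        simp only [hM']
        rw [Function.update_of_ne (by omega), Function.update_of_ne (by omega),
          Function.update_of_ne (by omega)]
      · exact (hqueue 0 hS.pos.ne).trans hS.first
      · intro i hi
        by_cases hin : i = n
        · subst hin
          exact ⟨e, he, hlast⟩
        · simp only [hqueue i hin]
          exact hS.node i (by omega)
      · intro i hi k hk hik
        simp only at hik
        by_cases hin : i = n <;> by_cases hkn : k = n
        · omega
        · rw [hin, hlast, hqueue k hkn] at hik
          exact absurd hik.symm (hnew k (by omega))
        · rw [hkn, hlast, hqueue i hin] at hik
          exact absurd hik (hnew i (by omega))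
        · rw [hqueue i hin, hqueue k hkn] at hik
          exact hS.inj i (by omega) k (by omega) hik
      · rintro _ ⟨i, hi, rfl⟩
        simp only
        by_cases hie : i = e
        · subst hie
          exact iff_of_true hmark' ⟨n, by omega, hlast⟩
        · rw [hmark i hie, hS.mark _ ⟨i, hi, rfl⟩]
          refine ⟨hinto _, ?_⟩
          rintro ⟨k, hk, hka⟩
          by_cases hkn : k = n
          · rw [hkn, hlast] at hka
            omega
          · exact ⟨k, by omega, by rw [← hka, hqueue k hkn]⟩
      · rintro _ ⟨i, hi, rfl⟩
        simp only
        by_cases hie : i = e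
        · subst hie
          exact Or.inr hmark'.ge
        · rw [hmark i hie]
          exact hS.old _ ⟨i, hi, rfl⟩
      · intro i hi hi0
        simp only
        by_cases hin : i = n
        · subst hin
          rw [hlast, hpar']
          refine ⟨h, hhn, j, hj, ?_⟩
          rw [hqueue h (by omega), hcp]
          exact ⟨rfl, hw, hne1⟩
        · obtain ⟨k, hk, l, hl, h1, h2, h3⟩ := hS.parent i (by omega) hi0
          refine ⟨k, hk, l, hl, ?_⟩
          rw [hqueue i hin, hqueue k (by omega)]
          refine ⟨?_, h2, h3⟩
          obtain ⟨d, hd, hid⟩ := hS.node i (by omega)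
          have hde : d ≠ e := fun hh => hnew i (by omega) (by rw [hid, hh])
          rw [hid] at h1 ⊢
          rw [hpar d hde, h1]
      · intro i hi l hl hil
        simp only
        by_cases hin : i = n
        · omega
        · rw [hqueue i hin]
          intro hcl
          by_cases hlj : i = h ∧ l = j
          · obtain ⟨rfl, rfl⟩ := hlj
            rw [hcp, hw]
            exact ⟨n, by omega, hlast⟩
          · exact hinto _ (hS.closed i (by omega) l hl (by omega) hcl)
      · simp only [Function.update_apply, Nat.reduceEqDiff, reduceIte]
        rcases hS.found with ⟨h1, h2⟩ | ⟨i, hi, h1, h2⟩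
        · refine Or.inl ⟨h1, fun i hi hih => ?_⟩
          rw [hqueue i (by omega)]
          exact h2 i (by omega) hih
        · exact Or.inr ⟨i, by omega, by rw [hqueue i (by omega)]; exact h1, h2⟩
    · rw [if_neg (by omega), if_neg (by omega), if_neg (by omega), hcp]
  · intro h0
    refine ⟨n, le_rfl, { hS with closed := ?_ }, hcp.symm, hhead⟩
    intro i hi l hl hil
    by_cases hlj : i = h ∧ l = j
    · obtain ⟨rfl, rfl⟩ := hlj
      rw [hcp]
      intro hne
      rcases h0 with h0 | h0
      · exact absurd h0 hne
      · have hw0 : M (p₀ + 16 * c + l) ≠ 0 := fun h0 => hne (hN.absent _ ⟨c, hc, rfl⟩ l hj h0)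
        obtain ⟨w, hw, -, -, hwe, -⟩ := hN.rev _ ⟨c, hc, rfl⟩ l hj hw0
        rw [hwe] at h0 ⊢
        exact (hS.mark w hw).1 h0
    · exact hS.closed i hi l hl (by omega)

/-- Process the first node of the queue. -/
def searchStep : Prog :=
  .seq (.seq (.assign rNode (.fld (.reg rHead) 14)) (.assign rHead (.add (.reg rHead) (.lit 16)))) <|
    .seq (visit 0) <| .seq (visit 1) <| .seq (visit 2) <| .seq (visit 3) <|
    .ite (.ne (.fld (.reg rNode) 15) (.load (.lit 3))) .skip (.assign rFound (.reg rNode))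

theorem searchStep_spec {W b p₀ N K q n h : ℕ} {M : ℕ → ℕ} {σ : State} (hs : Sizes W b)
    (hN : Net p₀ N K M) (hb : p₀ + 16 * N + 16 ≤ b) (hσ : Bounded b σ) (hhn : h < n)
    (hhead : σ.reg rHead = p₀ + 16 * h) (hS : Search p₀ N q (M 3) M n h 0 σ) :
    Run W b searchStep 1000 σ fun τ => ∃ n', Search p₀ N q (M 3) M n' (h + 1) 0 τ ∧ h < n' ∧
      τ.reg rHead = p₀ + 16 * (h + 1) := by
  have hnN := hS.card_le
  have hpos := hN.pos
  have hdvd := hN.dvd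
  refine Run.mono (Run.seq (T' := (visit 0).cost + ((visit 1).cost +
    ((visit 2).cost + ((visit 3).cost + 20)))) (Run.of_wp hs (by decide) hσ
    (Q := fun τ => Search p₀ N q (M 3) M n h 0 τ ∧ τ.reg rNode = τ.mem (p₀ + 16 * h + 14) ∧
      τ.reg rHead = p₀ + 16 * h + 16) ?_) ?_) ?_ fun τ _ h => h
  · simp only [wp, Expr.eval_fld, Expr.eval, hhead, Function.update_apply, reduceIte,
      Nat.reduceEqDiff, and_true]
    refine ⟨hσ.2 _, by omega, ?_⟩
    exact { hS with
      out := by simpa using hS.out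
      rounds := by simpa using hS.rounds
      src := by simpa using hS.src
      tail := by simpa using hS.tail
      found := by simpa using hS.found }
  · rintro τ hτ ⟨h1, h2, h3⟩
    refine Run.seq (visit_spec hs hN hb (by omega) hτ hhn h2 h3 h1) ?_
    rintro τ hτ ⟨n1, hn1, h1, h2, h3⟩
    refine Run.seq (visit_spec hs hN hb (by omega) hτ (by omega) h2 h3 h1) ?_
    rintro τ hτ ⟨n2, hn2, h1, h2, h3⟩
    refine Run.seq (visit_spec hs hN hb (by omega) hτ (by omega) h2 h3 h1) ?_
    rintro τ hτ ⟨n3, hn3, h1, h2, h3⟩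
    refine Run.seq (visit_spec hs hN hb (by omega) hτ (by omega) h2 h3 h1) ?_
    rintro τ hτ ⟨n4, hn4, h1, h2, h3⟩
    refine Run.mono (Run.of_wp hs (by decide) hτ (Q := _) ?_) (by decide) fun _ _ h => h
    obtain ⟨c, hc, hcp⟩ := h1.node h (by omega)
    have e1 : τ.mem 3 = M 3 := h1.same _ (by omega)
    have e2 : τ.mem (τ.reg rNode + 15) = M (τ.reg rNode + 15) := h1.same _ (by omega)
    have hclosed : ∀ i < n4, ∀ j < 4, i < h + 1 ∨ i = h + 1 ∧ j < 0 →
        M (τ.mem (p₀ + 16 * i + 14) + j + 4) ≠ 0 →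
        ∃ k < n4, τ.mem (p₀ + 16 * k + 14) = M (τ.mem (p₀ + 16 * i + 14) + j) :=
      fun i hi j hj hij => h1.closed i hi j hj (by omega)
    simp only [wp, ne_eq, Expr.eval_ne, Expr.eval_fld, Expr.eval, e1, e2]
    constructor
    · intro hne
      refine ⟨n4, { h1 with closed := hclosed, found := ?_ }, by omega, by omega⟩
      rcases h1.found with ⟨h4, h5⟩ | h4
      · refine Or.inl ⟨h4, fun i hi hih => ?_⟩
        by_cases hh : i = h
        · rw [hh, ← h2]
          exact hne
        · exact h5 i hi (by omega)
      · exact Or.inr h4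
    · intro heq
      refine ⟨hτ.1 _, n4, ?_, by omega, by simp; omega⟩
      exact { h1 with
        out := by simpa using h1.out
        rounds := by simpa using h1.rounds
        src := by simpa using h1.src
        tail := by simpa using h1.tail
        closed := hclosed
        found := Or.inr ⟨h, by omega, by simpa using h2, by simpa using heq⟩ }
  · decide

/-- Breadth-first search in the residual network. -/
def search : Prog :=
  .seq (.seq (.assign rHead (.reg rSrc)) <| .seq (.assign rTail (.add (.reg rSrc) (.lit 16))) <|
    .seq (.store (.add (.reg rSrc) (.lit 12)) (.reg rRounds)) <|
    .seq (.store (.add (.reg rSrc) (.lit 14)) (.reg rSrc)) <| .assign rFound (.lit 0)) <|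
  .while (.sub (.reg rTail) (.reg rHead)) searchStep

/-- Every iteration processes one queue entry through at most four edges, and there are at most `N`
entries. At the end all entries are processed, so the set found is closed under residual edges. -/
theorem search_spec {W b p₀ N K q : ℕ} {M : ℕ → ℕ} {σ : State} (hs : Sizes W b)
    (hN : Net p₀ N K M) (hb : p₀ + 16 * N + 16 ≤ b) (hσ : Bounded b σ) (hN0 : 0 < N)
    (hmem : σ.mem = M) (hout : σ.reg 0 = 1) (hq : σ.reg rRounds = q) (hq0 : 0 < q)
    (hsrc : σ.reg rSrc = p₀) (hmark : ∀ p, IsNode p₀ N p → M (p + 12) = 0 ∨ q < M (p + 12)) :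
    Run W b search (1100 * N + 100) σ fun τ => ∃ n, Search p₀ N q (M 3) M n n 0 τ := by
  subst hmem
  have hpos := hN.pos
  have hdvd := hN.dvd
  refine Run.mono (Run.seq (T' := N * (1000 + 3 + 1) + (3 + 1)) (Run.of_wp hs (by decide) hσ
    (Q := fun τ => Search p₀ N q (σ.mem 3) σ.mem 1 0 0 τ ∧ τ.reg rHead = p₀ + 16 * 0) ?_) ?_)
      ?_ fun τ _ h => h
  · simp only [wp, Expr.eval, hsrc, hq, Function.update_apply, reduceIte,
      Nat.reduceEqDiff]
    refine ⟨by omega, by omega, hq ▸ hσ.1 _, by omega, by omega, ?_, rfl⟩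
    obtain ⟨M', hM'⟩ : ∃ M', M' = Function.update
          (Function.update σ.mem (p₀ + 12) q) (p₀ + 14) p₀ := ⟨_, rfl⟩
    rw [← hM']
    have h14 : M' (p₀ + 14) = p₀ := by rw [hM', Function.update_self]
    have h12 : M' (p₀ + 12) = q := by
      rw [hM', Function.update_of_ne (by omega), Function.update_self]
    have hrest : ∀ a, a ≠ p₀ + 12 → a ≠ p₀ + 14 → M' a = σ.mem a := by
      intro a h1 h2
      rw [hM', Function.update_of_ne h2, Function.update_of_ne h1]
    refine ⟨by simpa using hout, by simpa using hq, by simpa using hsrc, by simp, ?_, by omega,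
      h14, ?_, ?_, ?_, ?_, ?_, ?_, ?_⟩
    · intro a ha
      exact hrest a (by omega) (by omega)
    · intro i hi
      obtain rfl : i = 0 := by omega
      exact ⟨0, hN0, h14⟩
    · intro i hi k hk _
      omega
    · rintro _ ⟨i, hi, rfl⟩
      by_cases h0 : i = 0
      · subst h0
        exact iff_of_true h12 ⟨0, by omega, h14⟩
      · simp only
        rw [hrest _ (by omega) (by omega)]
        refine iff_of_false ?_ ?_
        · have := hmark _ ⟨i, hi, rfl⟩
          omega
        · rintro ⟨k, hk, hk'⟩
          obtain rfl : k = 0 := by omega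
          rw [mul_zero, add_zero, h14] at hk'
          omega
    · rintro _ ⟨i, hi, rfl⟩
      by_cases h0 : i = 0
      · subst h0
        exact Or.inr h12.ge
      · simp only
        rw [hrest _ (by omega) (by omega)]
        have := hmark _ ⟨i, hi, rfl⟩
        omega
    · intro i hi h0
      omega
    · intro i hi j hj hij
      omega
    · exact Or.inl ⟨by simp, fun i _ hi => by omega⟩
  · rintro τ hτ ⟨h1, h2⟩
    refine Run.mono (Run.loop hs (T := 1000) (by decide) (fun k τ => ∃ n h, h ≤ n ∧ k + h = N ∧
      Search p₀ N q (σ.mem 3) σ.mem n h 0 τ ∧ τ.reg rHead = p₀ + 16 * h) ?_ N τ hτ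
      ⟨1, 0, by omega, by omega, h1, h2⟩) le_rfl ?_
    · rintro k τ hτ ⟨n, h, hhn, hk, h1, h2⟩ hne
      simp only [Expr.eval, h1.tail, h2] at hne
      have := h1.card_le
      refine ⟨k - 1, by omega, ?_⟩
      refine Run.mono (searchStep_spec hs hN hb hτ (by omega) h2 h1) le_rfl ?_
      rintro τ hτ ⟨n', h3, h4, h5⟩
      exact ⟨n', h + 1, by omega, by omega, h3, h5⟩
    · rintro τ hτ ⟨k, ⟨n, h, hhn, hk, h1, h2⟩, he⟩
      simp only [Expr.eval, h1.tail, h2] at he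
      obtain rfl : h = n := by omega
      exact ⟨h, h1⟩
  · simp only [Prog.cost, Expr.cost]
    omega

/-! ### Augmentation -/

/-- Push one unit of flow along the edge through which the current node was found. -/
def augmentStep : Prog :=
  .seq (.assign rEdge (.fld (.reg rAux) 13)) <|
    .seq (.assign rNode (.fld (.reg rEdge) 8)) <|
    .seq (.store (.add (.reg rEdge) (.lit 4)) (.sub (.fld (.reg rEdge) 4) (.lit 1))) <|
    .seq (.store (.add (.reg rNode) (.lit 4)) (.add (.fld (.reg rNode) 4) (.lit 1))) <|
    .assign rAux (.load (.reg rNode))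

/-- Push one unit of flow along the path from the source to the node that was found. -/
def augment : Prog :=
  .seq (.assign rAux (.reg rFound)) <| .while (.ne (.reg rAux) (.reg rSrc)) augmentStep

open Classical in
/-- The state during the augmentation of a path to the node `f`: the path has been processed from
`f` back to the `i`-th node of the queue. The memory `M` is the one after the search. -/
structure Augment (p₀ N K q f : ℕ) (M : ℕ → ℕ) (i : ℕ) (σ : State) : Prop where
  out : σ.reg 0 = 1
  rounds : σ.reg rRounds = q
  src : σ.reg rSrc = p₀
  aux : σ.reg rAux = M (p₀ + 16 * i + 14)
  net : Net p₀ N K σ.mem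
  same : ∀ a, ¬ (p₀ ≤ a ∧ 4 ≤ a % 16 ∧ a % 16 < 8) → σ.mem a = M a
  -- The parent edges of all nodes up to queue position `i` still have residual capacity; this
  -- includes the rest of the path.
  pos : ∀ k ≤ i, 0 < k → σ.mem (M (M (p₀ + 16 * k + 14) + 13) + 4) ≠ 0
  -- `Net.cutCap_push` telescopes along the path: only the indicators of its two ends remain.
  cut : ∀ S : Set ℕ, cutCap p₀ N σ.mem S + (if M (p₀ + 16 * i + 14) ∈ S then 1 else 0) =
    cutCap p₀ N M S + if f ∈ S then 1 else 0

theorem augmentStep_spec {W b p₀ N K q f n i : ℕ} {M : ℕ → ℕ} {σ τ₀ : State} (hs : Sizes W b)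
    (hb : p₀ + 16 * N + 16 ≤ b) (hK : K ≤ b) (hσ : Bounded b σ)
    {M₀ : ℕ → ℕ} {z : ℕ} (hM : τ₀.mem = M) (hS : Search p₀ N q z M₀ n n 0 τ₀) (hin : i < n)
    (hA : Augment p₀ N K q f M i σ) (hne : σ.reg rAux ≠ p₀) :
    Run W b augmentStep augmentStep.cost σ fun τ => ∃ k < i, Augment p₀ N K q f M k τ := by
  subst hM
  have hpos := hA.net.pos
  have hdvd := hA.net.dvd
  have hi0 : 0 < i := by
    rcases Nat.eq_zero_or_pos i with rfl | h
    · exact absurd (hA.aux.trans hS.first) hne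
    · exact h
  obtain ⟨k, hki, j, hj, h1, h2, h3⟩ := hS.parent i hin hi0
  obtain ⟨c, hc, hck⟩ := hS.node k (by omega)
  obtain ⟨d, hd, hdi⟩ := hS.node i hin
  have hcap := hA.pos i le_rfl hi0
  rw [h1, hck] at hcap
  rw [hck] at h1 h2
  have e1 : σ.mem (σ.reg rAux + 13) = p₀ + 16 * c + j := by
    rw [hA.aux, hdi, hA.same _ (by omega), ← hdi, h1]
  have e2 : σ.mem (p₀ + 16 * c + j) = p₀ + 16 * d := by
    rw [hA.same _ (by omega), hS.same _ (by omega), h2, hdi]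
  obtain ⟨_, ⟨d', hd', rfl⟩, l, hl, g1, g2, g3, g4, g5, g6⟩ :=
    hA.net.rev _ ⟨c, hc, rfl⟩ j hj (by omega)
  have hdd : d' = d := by omega
  subst hdd
  apply Run.of_wp hs (by decide) hσ
  have hpush : Function.update (Function.update σ.mem (p₀ + 16 * c + j + 4)
      (σ.mem (p₀ + 16 * c + j + 4) - 1)) (p₀ + 16 * d' + l + 4)
        (σ.mem (p₀ + 16 * d' + l + 4) + 1) = push σ.mem (p₀ + 16 * c + j) := by
    rw [push, g2]
  have hload : push σ.mem (p₀ + 16 * c + j) (p₀ + 16 * d' + l) = p₀ + 16 * c := by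
    rw [push_apply_of_ne (by omega) (by omega), g3]
  have hupd : Function.update σ.mem (p₀ + 16 * c + j + 4)
      (σ.mem (p₀ + 16 * c + j + 4) - 1) (p₀ + 16 * d' + l + 4) =
        σ.mem (p₀ + 16 * d' + l + 4) := Function.update_of_ne (by omega) _ _
  simp only [augmentStep, wp, Expr.eval_fld, Expr.eval, e1, Function.update_self, ne_eq, g2,
    not_false_eq_true, Function.update_of_ne, Nat.reduceEqDiff, hupd, hpush, hload]
  refine ⟨by omega, by omega, by omega, by omega, by omega, k, hki, ?_⟩
  refine ⟨by simpa using hA.out, by simpa using hA.rounds, by simpa using hA.src, by simp [hck],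
    hA.net.push ⟨c, hc, rfl⟩ hj hcap, ?_, ?_, ?_⟩
  · intro a ha
    rw [← hA.same a ha]
    exact push_apply_of_ne (by omega) (by omega)
  · intro k' hk' hk0
    have hpk := hA.pos k' (by omega) hk0
    simp only [← hpush, Function.update_apply, Nat.add_right_cancel_iff]
    -- A reverse edge has only gained capacity. The edge just used cannot be the parent edge of an
    -- earlier queue entry, since its end is the entry at position `i` and entries are distinct.
    split_ifs with i1 i2
    · omega
    · obtain ⟨c', hc', j', hj', l1, l2, l3⟩ := hS.parent k' (by omega) hk0
      rw [i2, ← hck] at l1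
      have hcc : M₀ (τ₀.mem (p₀ + 16 * k + 14) + j) = τ₀.mem (p₀ + 16 * k' + 14) := by
        rw [l1, l2]
      rw [hck, h2] at hcc
      have := hS.inj i hin k' (by omega) hcc
      omega
    · exact hpk
  · intro S
    have := hA.net.cutCap_push ⟨c, hc, rfl⟩ hj hcap S
    have h5 := hA.cut S
    rw [e2] at this
    rw [hdi] at h5
    rw [hck]
    simp only
    omega

-- For a cut, the source end of the path lies inside and the target end outside, so the telescoped
-- identity of `Augment.cut` gives a loss of exactly 1.
open Classical in
theorem augment_spec {W b p₀ N K q n : ℕ} {σ : State} (hs : Sizes W b)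
    (hb : p₀ + 16 * N + 16 ≤ b) (hK : K ≤ b) (hσ : Bounded b σ)
    {M₀ : ℕ → ℕ} {z : ℕ} (hN : Net p₀ N K M₀) (hS : Search p₀ N q z M₀ n n 0 σ)
    (hf : σ.reg rFound ≠ 0) :
    Run W b augment (100 * N + 100) σ fun τ => τ.reg 0 = 1 ∧ τ.reg rRounds = q ∧
      τ.reg rSrc = p₀ ∧ Net p₀ N K τ.mem ∧
      (∀ a, ¬ (p₀ ≤ a ∧ 4 ≤ a % 16 ∧ a % 16 < 8) → τ.mem a = σ.mem a) ∧
      ∀ S, IsCut p₀ N z M₀ S → cutCap p₀ N τ.mem S + 1 = cutCap p₀ N M₀ S := by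
  obtain ⟨i, hi, hfi, hfz⟩ := hS.found.resolve_left fun h => hf h.1
  have hnN := hS.card_le
  have hnet := hS.same.net hN
  refine Run.mono (Run.seq (T' := N * (augmentStep.cost + 7 + 1) + (7 + 1))
    (Run.of_wp hs (by decide) hσ
      (Q := fun τ => Augment p₀ N K q (σ.reg rFound) σ.mem i τ) ?_) ?_) ?_ fun τ _ h => h
  · refine ⟨hσ.1 _, by simpa using hS.out, by simpa using hS.rounds, by simpa using hS.src,
      by simpa [Expr.eval] using hfi, hnet, fun a _ => rfl, ?_, ?_⟩
    · intro k hk hk0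
      obtain ⟨k', hk', j, hj, h1, h2, h3⟩ := hS.parent k (by omega) hk0
      have hdvd := hN.dvd
      obtain ⟨c, hc, hck⟩ := hS.node k' (by omega)
      simp only
      rw [h1, hck, hS.same _ (by omega), ← hck]
      exact h3
    · intro S
      simp only [hfi]
  · intro τ hτ hA
    have hloop := Run.loop hs (e := .ne (.reg rAux) (.reg rSrc)) (T := augmentStep.cost)
      (P := augmentStep) (by decide)
      (fun k τ => ∃ i ≤ k, i < n ∧ Augment p₀ N K q (σ.reg rFound) σ.mem i τ) ?_ N τ hτ
      ⟨i, by omega, hi, hA⟩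
    · refine Run.mono hloop le_rfl ?_
      rintro τ hτ ⟨k, ⟨i, hik, hin, hA⟩, he⟩
      rw [Expr.eval_ne] at he
      simp only [Expr.eval] at he
      refine ⟨hA.out, hA.rounds, hA.src, hA.net, hA.same, fun S hSc => ?_⟩
      have h1 := hA.cut S
      have h2 : σ.reg rFound ∉ S := by
        intro hmem
        refine hSc.target _ ?_ hmem hfz
        obtain ⟨i, hi, h, -⟩ := hS.found.resolve_left fun h => hf h.1
        exact h ▸ hS.node i hi
      rw [if_neg h2, ← hA.aux, he, hA.src, if_pos hSc.source,
        hS.same.cutCap hN.dvd] at h1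
      exact h1
    · rintro k τ hτ ⟨i, hik, hin, hA⟩ he
      rw [ne_eq, Expr.eval_ne] at he
      simp only [Expr.eval, hA.src] at he
      have hi0 : i ≠ 0 := by
        rintro rfl
        exact he (hA.aux.trans hS.first)
      refine ⟨k - 1, by omega, ?_⟩
      refine Run.mono (augmentStep_spec hs hb hK hτ rfl hS hin hA he) le_rfl ?_
      rintro τ hτ ⟨k', hk', h⟩
      exact ⟨k', by omega, by omega, h⟩
  · simp only [Prog.cost, Expr.cost, augmentStep, Expr.fld]
    omega

/-! ### Maximum flow -/

/-- Increase the flow by one, or reject if that is impossible. -/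
def flowRound : Prog :=
  .seq search <| .ite (.reg rFound)
    (.seq augment (.assign rRounds (.sub (.reg rRounds) (.lit 1))))
    (.seq (.assign 0 (.lit 0)) (.assign rRounds (.lit 0)))

/-- The state after `q₀ - q` successful rounds. -/
structure Flow (p₀ N K q₀ : ℕ) (M : ℕ → ℕ) (q : ℕ) (σ : State) : Prop where
  out : σ.reg 0 = 1
  rounds : σ.reg rRounds = q
  le : q ≤ q₀
  src : σ.reg rSrc = p₀
  net : Net p₀ N K σ.mem
  -- Cell 13, the time key during linking, is not preserved: the search overwrites it with parent
  -- edges.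
  same : ∀ a, a < p₀ ∨ a % 16 = 15 → σ.mem a = M a
  mark : ∀ p, IsNode p₀ N p → σ.mem (p + 12) = 0 ∨ q < σ.mem (p + 12)
  cut : ∀ S, IsCut p₀ N (M 3) M S → cutCap p₀ N σ.mem S + (q₀ - q) = cutCap p₀ N M S

/-- The computation has failed because of a small cut. -/
def Rejected (p₀ N q₀ : ℕ) (M : ℕ → ℕ) (σ : State) : Prop :=
  σ.reg 0 = 0 ∧ σ.reg rRounds = 0 ∧ ∃ S, IsCut p₀ N (M 3) M S ∧ cutCap p₀ N M S < q₀

/-- If the search misses `z`, the nodes found form a cut of residual capacity 0. By `Flow.cut` its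
original capacity is `q₀ - q`, which is less than `q₀` because `q > 0`. -/
theorem flowRound_spec {W b p₀ N K q₀ q : ℕ} {M : ℕ → ℕ} {σ : State} (hs : Sizes W b)
    (hb : p₀ + 16 * N + 16 ≤ b) (hK : K ≤ b) (hN0 : 0 < N) (hσ : Bounded b σ)
    (hF : Flow p₀ N K q₀ M q σ) (hq : 0 < q) :
    Run W b flowRound (1200 * N + 300) σ fun τ =>
      Flow p₀ N K q₀ M (q - 1) τ ∨ Rejected p₀ N q₀ M τ := by
  have hdvd := hF.net.dvd
  have hpos := hF.net.pos
  have hle := hF.le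
  have hz : σ.mem 3 = M 3 := hF.same 3 (by omega)
  have hcut : ∀ S, IsCut p₀ N (M 3) M S ↔ IsCut p₀ N (M 3) σ.mem S := by
    intro S
    constructor
    · rintro ⟨h1, h2⟩
      refine ⟨h1, ?_⟩
      rintro _ ⟨i, hi, rfl⟩ hp
      rw [hF.same _ (by omega)]
      exact h2 _ ⟨i, hi, rfl⟩ hp
    · rintro ⟨h1, h2⟩
      refine ⟨h1, ?_⟩
      rintro _ ⟨i, hi, rfl⟩ hp
      rw [← hF.same _ (by omega)]
      exact h2 _ ⟨i, hi, rfl⟩ hp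
  refine Run.mono (Run.seq (T' := 2 + ((100 * N + 100 + 4) + 4)) (search_spec hs hF.net hb hσ hN0
    rfl hF.out hF.rounds hq hF.src hF.mark) ?_) (by omega) fun _ _ h => h
  rintro τ hτ ⟨n, hS⟩
  rw [hz] at hS
  refine Run.ite hs (e := .reg rFound) hτ (by decide) ?_ ?_
  · intro hf
    refine Run.seq (augment_spec hs hb hK hτ hF.net hS hf) ?_
    rintro υ hυ ⟨h1, h2, h3, h4, h5, h6⟩
    refine Run.of_wp hs (by decide) hυ ?_
    simp only [wp, Expr.eval, h2]
    have hqb : υ.reg rRounds ≤ b := hυ.1 _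
    refine ⟨by omega, Or.inl ⟨by simpa using h1, by simp, by omega, by simpa using h3, h4,
      ?_, ?_, ?_⟩⟩
    · intro a ha
      rw [← hF.same a ha, ← hS.same a (by omega), ← h5 a (by omega)]
    · rintro _ ⟨i, hi, rfl⟩
      have := hS.old _ ⟨i, hi, rfl⟩
      rw [← h5 _ (by omega)] at this
      simp only
      omega
    · intro S hSc
      have e1 := h6 S ((hcut S).1 hSc)
      have e2 := hF.cut S hSc
      simp only
      omega
  · intro hf
    refine Run.of_wp hs (by decide) hτ ?_
    simp only [wp, Expr.eval]
    refine ⟨by omega, by omega, Or.inr ⟨by simp, by simp, {p | ∃ i < n,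
      τ.mem (p₀ + 16 * i + 14) = p}, ?_⟩⟩
    have hnot := (hS.found.resolve_right ?_).2
    · have hSc : IsCut p₀ N (M 3) M {p | ∃ i < n, τ.mem (p₀ + 16 * i + 14) = p} := by
        rw [hcut]
        refine ⟨⟨0, hS.pos, hS.first⟩, ?_⟩
        rintro _ - ⟨i, hi, rfl⟩
        exact hnot i hi hi
      refine ⟨hSc, ?_⟩
      have h0 : cutCap p₀ N σ.mem {p | ∃ i < n, τ.mem (p₀ + 16 * i + 14) = p} = 0 := by
        refine Finset.sum_eq_zero ?_
        rintro ⟨c, j⟩ hx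
        simp only [Finset.mem_product, Finset.mem_range] at hx
        simp only [ite_eq_right_iff, and_imp]
        rintro ⟨i, hi, hci⟩ hnot
        by_contra hcap
        rw [← hci] at hcap hnot
        exact hnot (hS.closed i hi j hx.2 (Or.inl hi) hcap)
      have := hF.cut _ hSc
      omega
    · rintro ⟨i, hi, h1, -⟩
      obtain ⟨c, hc, hci⟩ := hS.node i hi
      simp only [Expr.eval] at hf
      omega

/-- Decide whether the flow has value at least the number of rounds. -/
def maxFlow : Prog := .while (.reg rRounds) flowRound

theorem maxFlow_spec {W b p₀ N K q₀ : ℕ} {M : ℕ → ℕ} {σ : State} (hs : Sizes W b)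
    (hb : p₀ + 16 * N + 16 ≤ b) (hK : K ≤ b) (hN0 : 0 < N) (hσ : Bounded b σ)
    (hF : Flow p₀ N K q₀ M q₀ σ) :
    Run W b maxFlow (q₀ * (1200 * N + 302) + 2) σ fun τ =>
      (τ.reg 0 = 1 ∧ ∀ S, IsCut p₀ N (M 3) M S → q₀ ≤ cutCap p₀ N M S) ∨
      (τ.reg 0 = 0 ∧ ∃ S, IsCut p₀ N (M 3) M S ∧ cutCap p₀ N M S < q₀) := by
  refine Run.mono (Run.loop hs (e := .reg rRounds) (T := 1200 * N + 300) (P := flowRound)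
    (by decide) (fun k τ => Flow p₀ N K q₀ M k τ ∨ Rejected p₀ N q₀ M τ) ?_ q₀ σ hσ (Or.inl hF))
    le_rfl ?_
  · rintro k τ hτ (h | h) he
    · have hk : k ≠ 0 := h.rounds ▸ he
      exact ⟨k - 1, by omega, flowRound_spec hs hb hK hN0 hτ h (by omega)⟩
    · exact absurd h.2.1 he
  · rintro τ hτ ⟨k, h | h, he⟩
    · refine Or.inl ⟨h.out, fun S hS => ?_⟩
      have h1 := h.cut S hS
      have h2 : k = 0 := h.rounds ▸ he
      omega
    · exact Or.inr ⟨h.1, h.2.2⟩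

/-! ### The records of the events -/

/-- The `48` cells from `P` on for a time arc `(v, w, t, l)`: the records of its arrival, of its
delayed arrival and of its departure. -/
def arcRecord (P K v w t l δ : ℕ) : ℕ → ℕ :=
  (fun M : ℕ → ℕ => Function.update M 27 (P + 35)) <|
  (fun M : ℕ → ℕ => Function.update M 19 (P + 32)) <|
  (fun M : ℕ → ℕ => Function.update M 43 (P + 19)) <|
  (fun M : ℕ → ℕ => Function.update M 39 K) <|
  (fun M : ℕ → ℕ => Function.update M 35 (P + 16)) <|
  (fun M : ℕ → ℕ => Function.update M 10 (P + 34)) <|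
  (fun M : ℕ → ℕ => Function.update M 2 (P + 32)) <|
  (fun M : ℕ → ℕ => Function.update M 42 (P + 2)) <|
  (fun M : ℕ → ℕ => Function.update M 38 1) <|
  (fun M : ℕ → ℕ => Function.update M 34 (P + 0)) <|
  (fun M : ℕ → ℕ => Function.update M 45 (t + t + 1)) <|
  (fun M : ℕ → ℕ => Function.update M 47 v) <|
  (fun M : ℕ → ℕ => Function.update M 29 (t + l + δ + (t + l + δ))) <|
  (fun M : ℕ → ℕ => Function.update M 31 w) <|
  (fun M : ℕ → ℕ => Function.update M 13 (t + l + (t + l))) <|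
  (fun M : ℕ → ℕ => Function.update M 15 w) fun _ => 0

/-- Write the records of one time arc. -/
def arcStep : Prog :=
  let st (k : ℕ) (e : Expr) : Prog := .store (.add (.reg rNode) (.lit k)) e
  let cell (k : ℕ) : Expr := .add (.reg rNode) (.lit k)
  -- Before the search the registers have other roles: `rHead` reads the input, `rNode` is the write
  -- position and `rTail` counts the arcs left. The keys are `2 * time` for arrivals and `2 * time +
  -- 1` for departures, so an arrival precedes a departure at the same time.
  .seq (.assign 9 (.load (.reg rHead))) <| .seq (.assign 10 (.fld (.reg rHead) 1)) <|
  .seq (.assign 11 (.fld (.reg rHead) 2)) <| .seq (.assign 12 (.fld (.reg rHead) 3)) <|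
  .seq (.assign 13 (.add (.load (.lit 1)) (.lit 1))) <| .seq (.assign 14 (.load (.lit 5))) <|
  .seq (st 15 (.reg 10)) <|
  .seq (st 13 (.add (.add (.reg 11) (.reg 12)) (.add (.reg 11) (.reg 12)))) <|
  .seq (st 31 (.reg 10)) <|
  .seq (st 29 (.add (.add (.add (.reg 11) (.reg 12)) (.reg 14))
    (.add (.add (.reg 11) (.reg 12)) (.reg 14)))) <|
  .seq (st 47 (.reg 9)) <| .seq (st 45 (.add (.add (.reg 11) (.reg 11)) (.lit 1))) <|
  .seq (st 34 (cell 0)) <| .seq (st 38 (.lit 1)) <| .seq (st 42 (cell 2)) <|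
  .seq (st 2 (cell 32)) <| .seq (st 10 (cell 34)) <|
  .seq (st 35 (cell 16)) <| .seq (st 39 (.reg 13)) <| .seq (st 43 (cell 19)) <|
  .seq (st 19 (cell 32)) <| .seq (st 27 (cell 35)) <|
  .seq (.assign rNode (cell 48)) <| .seq (.assign rHead (.add (.reg rHead) (.lit 4))) <|
  .assign rTail (.sub (.reg rTail) (.lit 1))

/-- The memory after the records of the source and of the first `n` time arcs were written. -/
structure Records (p₀ : ℕ) (w : ℕ → ℕ) (n : ℕ) (M : ℕ → ℕ) : Prop where
  input : ∀ a < p₀, M a = w a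
  source : M (p₀ + 15) = w 2
  source_zero : ∀ k < 15, M (p₀ + k) = 0
  arc : ∀ i < n, ∀ k < 48, M (p₀ + 16 + 48 * i + k) = arcRecord (p₀ + 16 + 48 * i) (w 1 + 1)
    (w (6 + 4 * i)) (w (6 + 4 * i + 1)) (w (6 + 4 * i + 2)) (w (6 + 4 * i + 3)) (w 5) k
  rest : ∀ a, p₀ + 16 + 48 * n ≤ a → M a = 0

theorem arcStep_spec {W b p₀ m B n : ℕ} {w : ℕ → ℕ} {σ : State} (hs : Sizes W b)
    (hσ : Bounded b σ) (hw : ∀ a, w a ≤ B) (hm : w 1 = m) (hp : p₀ = 16 * (m + 1))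
    (hB : 10 * B + 10 ≤ b) (hb : p₀ + 48 * m + 100 ≤ b) (hn : n < m)
    (hsrc : σ.reg rSrc = p₀) (hnode : σ.reg rNode = p₀ + 16 + 48 * n)
    (hhead : σ.reg rHead = 6 + 4 * n) (htail : σ.reg rTail = m - n)
    (hR : Records p₀ w n σ.mem) :
    Run W b arcStep arcStep.cost σ fun τ => τ.reg rSrc = p₀ ∧
      τ.reg rNode = p₀ + 16 + 48 * (n + 1) ∧ τ.reg rHead = 6 + 4 * (n + 1) ∧
      τ.reg rTail = m - (n + 1) ∧ Records p₀ w (n + 1) τ.mem := by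
  apply Run.of_wp hs (by decide) hσ
  have e0 : σ.mem (6 + 4 * n) = w (6 + 4 * n) := hR.input _ (by omega)
  have e1 : σ.mem (6 + 4 * n + 1) = w (6 + 4 * n + 1) := hR.input _ (by omega)
  have e2 : σ.mem (6 + 4 * n + 2) = w (6 + 4 * n + 2) := hR.input _ (by omega)
  have e3 : σ.mem (6 + 4 * n + 3) = w (6 + 4 * n + 3) := hR.input _ (by omega)
  have e4 : σ.mem 1 = w 1 := hR.input _ (by omega)
  have e5 : σ.mem 5 = w 5 := hR.input _ (by omega)
  have b0 := hw (6 + 4 * n)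
  have b1 := hw (6 + 4 * n + 1)
  have b2 := hw (6 + 4 * n + 2)
  have b3 := hw (6 + 4 * n + 3)
  have b4 := hw 1
  have b5 := hw 5
  obtain ⟨P, hP⟩ : ∃ P, P = p₀ + 16 + 48 * n := ⟨_, rfl⟩
  rw [← hP] at hnode
  simp only [arcStep, wp, Expr.eval_fld, Expr.eval, ne_eq, hnode, hhead, htail, e0, e1, e2, e3, e4,
    e5, Function.update_self, not_false_eq_true, Function.update_of_ne, Nat.reduceEqDiff]
  refine ⟨by omega, by omega, by omega, by omega, by omega, by omega, by omega, by omega, by omega,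
    by omega, by omega, by omega, by omega, by omega, by omega, by omega, by omega, by omega,
    by omega, by omega, by omega, by omega, by omega, by omega, by omega, hsrc, by omega,
    by omega, by omega, ?_⟩
  obtain ⟨hin, hso, hsz, harc, hrest⟩ := hR
  refine ⟨fun a ha => ?_, ?_, fun k hk => ?_, fun i hi k hk => ?_, fun a ha => ?_⟩
  · rw [← hin a ha]
    iterate 16 rw [Function.update_of_ne (by omega)]
  · rw [← hso]
    iterate 16 rw [Function.update_of_ne (by omega)]
  · rw [← hsz k hk]
    iterate 16 rw [Function.update_of_ne (by omega)]
  · by_cases hin' : i = n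
    · subst hin'
      rw [← hP, arcRecord]
      simp only [Function.update_apply, Nat.add_left_cancel_iff]
      rw [hrest (P + k) (by omega)]
    · rw [← harc i (by omega) k hk]
      iterate 16 rw [Function.update_of_ne (by omega)]
  · rw [← hrest a (by omega)]
    iterate 16 rw [Function.update_of_ne (by omega)]

/-- Write the records of the source and of all time arcs. -/
def writeRecords : Prog :=
  .seq (.seq (.assign rSrc (.add (.load (.lit 1)) (.lit 1))) <|
    -- Four doublings give `16 * (m + 1)`: this lies beyond the `4 * m + 6` input words, and
    -- alignment lets residues modulo 16 identify the fields.
    .seq (.assign rSrc (.add (.reg rSrc) (.reg rSrc))) <|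
    .seq (.assign rSrc (.add (.reg rSrc) (.reg rSrc))) <|
    .seq (.assign rSrc (.add (.reg rSrc) (.reg rSrc))) <|
    .seq (.assign rSrc (.add (.reg rSrc) (.reg rSrc))) <|
    .seq (.store (.add (.reg rSrc) (.lit 15)) (.load (.lit 2))) <|
    .seq (.assign rNode (.add (.reg rSrc) (.lit 16))) <| .seq (.assign rHead (.lit 6)) <|
    .assign rTail (.load (.lit 1))) <|
  .while (.reg rTail) arcStep

theorem writeRecords_spec {W b p₀ m B : ℕ} {w : ℕ → ℕ} {σ : State} (hs : Sizes W b)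
    (hσ : Bounded b σ) (hw : ∀ a, w a ≤ B) (hm : w 1 = m) (hp : p₀ = 16 * (m + 1))
    (hB : 10 * B + 10 ≤ b) (hb : p₀ + 48 * m + 100 ≤ b) (hmem : σ.mem = w)
    (hw0 : ∀ a, p₀ ≤ a → w a = 0) :
    Run W b writeRecords (200 * m + 100) σ fun τ => τ.reg rSrc = p₀ ∧ Records p₀ w m τ.mem := by
  refine Run.mono (Run.seq (T' := m * (arcStep.cost + 1 + 1) + (1 + 1)) (Run.of_wp hs (by decide) hσ
    (Q := fun τ => τ.reg rSrc = p₀ ∧ τ.reg rNode = p₀ + 16 + 48 * 0 ∧ τ.reg rHead = 6 + 4 * 0 ∧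
      τ.reg rTail = m - 0 ∧ Records p₀ w 0 τ.mem) ?_) ?_) ?_ fun τ _ h => h
  · have hb2 := hw 2
    simp only [wp, Expr.eval, hmem, hm, Function.update_self, ne_eq, not_false_eq_true,
      Function.update_of_ne, Nat.reduceEqDiff]
    have hp' : m + 1 + (m + 1) + (m + 1 + (m + 1)) + (m + 1 + (m + 1) + (m + 1 + (m + 1))) +
        (m + 1 + (m + 1) + (m + 1 + (m + 1)) + (m + 1 + (m + 1) + (m + 1 + (m + 1)))) = p₀ := by
      omega
    rw [hp']
    refine ⟨by omega, by omega, by omega, by omega, by omega, by omega, by omega, by omega,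
      by omega, rfl, rfl, trivial, rfl, fun a ha => ?_, ?_, fun k hk => ?_, fun i hi => by omega,
      fun a ha => ?_⟩
    · rw [Function.update_of_ne (by omega)]
    · rw [Function.update_self]
    · rw [Function.update_of_ne (by omega), hw0 _ (by omega)]
    · rw [Function.update_of_ne (by omega), hw0 _ (by omega)]
  · intro τ hτ hI
    refine Run.mono (Run.loop hs (e := .reg rTail) (T := arcStep.cost) (P := arcStep) (by decide)
      (fun k τ => ∃ n ≤ m, k = m - n ∧ τ.reg rSrc = p₀ ∧ τ.reg rNode = p₀ + 16 + 48 * n ∧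
        τ.reg rHead = 6 + 4 * n ∧ τ.reg rTail = m - n ∧ Records p₀ w n τ.mem) ?_ m τ hτ
      ⟨0, by omega, by omega, hI⟩) le_rfl ?_
    · rintro k τ hτ ⟨n, hn, rfl, h1, h2, h3, h4, h5⟩ he
      simp only [Expr.eval, h4] at he
      refine ⟨m - (n + 1), by omega, ?_⟩
      refine Run.mono (arcStep_spec hs hτ hw hm hp hB hb (by omega) h1 h2 h3 h4 h5) le_rfl ?_
      exact fun τ _ h => ⟨n + 1, by omega, by omega, h⟩
    · rintro τ hτ ⟨k, ⟨n, hn, rfl, h1, h2, h3, h4, h5⟩, he⟩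
      simp only [Expr.eval, h4] at he
      obtain rfl : n = m := by omega
      exact ⟨h1, h5⟩
  · simp only [Prog.cost, Expr.cost, arcStep, Expr.fld]
    omega

/-! ### Linking the events of each vertex -/

/-- The order of the events: by time, ties being broken by the address of the record. -/
def Before (M : ℕ → ℕ) (p r : ℕ) : Prop :=
  M (p + 13) < M (r + 13) ∨ M (p + 13) = M (r + 13) ∧ p < r

/-- `r` is an event at the same vertex as `p`, and later. -/
def Later (M : ℕ → ℕ) (p r : ℕ) : Prop := M (p + 15) = M (r + 15) ∧ Before M p r

/-- `r` is the next event after `p` at the same vertex. -/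
structure IsNext (p₀ N : ℕ) (M : ℕ → ℕ) (p r : ℕ) : Prop where
  node : IsNode p₀ N r
  later : Later M p r
  first : ∀ r', IsNode p₀ N r' → Later M p r' → ¬ Before M r' r

/-- Of two distinct events at one vertex the earlier has the other as a later candidate, so `r`
cannot be next after both. Hence one slot per node suffices for the reverse of a waiting edge. -/
theorem IsNext.injective {p₀ N p p' r : ℕ} {M : ℕ → ℕ} (hp : IsNode p₀ N p)
    (hp' : IsNode p₀ N p') (h : IsNext p₀ N M p r) (h' : IsNext p₀ N M p' r) : p = p' := by
  have h1 := h.first p' hp'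
  have h2 := h'.first p hp
  have h3 := h.later
  have h4 := h'.later
  unfold Later Before at *
  omega

/-- Compare the event at `rAux` with the best candidate for the event after the one at
`rNode`. -/
def scanStep : Prog :=
  .seq (.ite (.ne (.fld (.reg rAux) 15) (.fld (.reg rNode) 15)) .skip
    -- The first operand tests that the candidate comes after `rNode`, the second that there is no
    -- best event yet or the best has a larger key. On equal keys the earlier candidate stays, which
    -- is right because addresses are scanned in increasing order.
    (.ite (.inf
        (.add (.sub (.fld (.reg rAux) 13) (.fld (.reg rNode) 13))
          (.inf (.sub (.reg rAux) (.reg rNode))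
            (.sub (.lit 1) (.sub (.fld (.reg rNode) 13) (.fld (.reg rAux) 13)))))
        (.add (.sub (.lit 1) (.reg rFound))
          (.sub (.fld (.reg rFound) 13) (.fld (.reg rAux) 13))))
      (.assign rFound (.reg rAux)) .skip)) <|
  .seq (.assign rAux (.add (.reg rAux) (.lit 16))) (.assign rEdge (.sub (.reg rEdge) (.lit 1)))

/-- The expression `3 * |E| + 1`, the number of nodes. -/
def nodeCount : Expr :=
  .add (.add (.load (.lit 1)) (.load (.lit 1))) (.add (.load (.lit 1)) (.lit 1))

/-- Find the event after the one at `rNode` at the same vertex. -/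
def scan : Prog :=
  .seq (.seq (.assign rFound (.lit 0)) <| .seq (.assign rAux (.reg rSrc)) <|
    .assign rEdge nodeCount) <|
  .while (.reg rEdge) scanStep

/-- The state after `c` candidates were compared. -/
structure Scan (p₀ N p k : ℕ) (M : ℕ → ℕ) (c : ℕ) (σ : State) : Prop where
  src : σ.reg rSrc = p₀
  tail : σ.reg rTail = k
  node : σ.reg rNode = p
  mem : σ.mem = M
  le : c ≤ N
  aux : σ.reg rAux = p₀ + 16 * c
  edge : σ.reg rEdge = N - c
  best : (σ.reg rFound = 0 ∧ ∀ i < c, ¬ Later M p (p₀ + 16 * i)) ∨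
    (∃ i < c, σ.reg rFound = p₀ + 16 * i) ∧ Later M p (σ.reg rFound) ∧
      ∀ i < c, Later M p (p₀ + 16 * i) → ¬ Before M (p₀ + 16 * i) (σ.reg rFound)

theorem scanStep_spec {W b p₀ N p k c : ℕ} {M : ℕ → ℕ} {σ : State} (hs : Sizes W b)
    (hσ : Bounded b σ) (hb : p₀ + 16 * N + 16 ≤ b) (hp0 : 0 < p₀)
    (hS : Scan p₀ N p k M c σ) (hc : c < N) :
    Run W b scanStep scanStep.cost σ fun τ => Scan p₀ N p k M (c + 1) τ := by
  apply Run.of_wp hs (by decide) hσ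
  obtain ⟨h1, h2, h3, h4, h5, h6, h7, h8⟩ := hS
  obtain ⟨f, hf⟩ : ∃ f, f = σ.reg rFound := ⟨_, rfl⟩
  rw [← hf] at h8
  simp only [scanStep, wp, ne_eq, Expr.eval_ne, Expr.eval_inf, Expr.eval_fld, Expr.eval, h3, h4,
    h6, h7, ← hf, not_false_eq_true, Function.update_of_ne,
    Nat.reduceEqDiff]
  obtain ⟨r, hr⟩ : ∃ r, r = p₀ + 16 * c := ⟨_, rfl⟩
  rw [← hr]
  have hsucc : ∀ {Q : ℕ → Prop}, (∀ i < c, Q (p₀ + 16 * i)) → Q r →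
      ∀ i < c + 1, Q (p₀ + 16 * i) := by
    intro Q hQ hQr i hi
    rcases Nat.lt_succ_iff_lt_or_eq.1 hi with h | rfl
    · exact hQ i h
    · exact hr ▸ hQr
  have hkeep : ((f = 0 ∧ ¬ Later M p r) ∨ (f ≠ 0 ∧ (Later M p r → ¬ Before M r f))) →
      (f = 0 ∧ ∀ i < c + 1, ¬ Later M p (p₀ + 16 * i)) ∨
      (∃ i < c + 1, f = p₀ + 16 * i) ∧ Later M p f ∧
        ∀ i < c + 1, Later M p (p₀ + 16 * i) → ¬ Before M (p₀ + 16 * i) f := by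
    intro hr'
    rcases h8 with ⟨g1, g2⟩ | ⟨⟨i, hi, hfi⟩, g2, g3⟩
    · exact Or.inl ⟨g1, hsucc (Q := fun x => ¬ Later M p x) g2 (hr'.resolve_right fun h => h.1 g1).2⟩
    · exact Or.inr ⟨⟨i, by omega, hfi⟩, g2,
        hsucc (Q := fun x => Later M p x → ¬ Before M x f) g3
          (hr'.resolve_left fun h => by omega).2⟩
  have hpos : ∀ i < c, p₀ + 16 * i < r := fun i hi => by omega
  have hfr : f = 0 ∨ f < r := by
    rcases h8 with ⟨g1, -⟩ | ⟨⟨i, hi, hfi⟩, -, -⟩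
    · exact Or.inl g1
    · exact Or.inr (hfi ▸ hpos i hi)
  refine ⟨fun hv => ⟨by omega, by omega, ?_⟩, fun hv => ⟨fun hc' => ⟨by omega, by omega, by omega,
    ?_⟩, fun hc' => ⟨by omega, by omega, ?_⟩⟩⟩
  · refine ⟨by simpa using h1, by simpa using h2, by simpa using h3, rfl, hc, by simp; omega,
      by simp; omega, ?_⟩
    simp only [Function.update_apply, Nat.reduceEqDiff, reduceIte, ← hf]
    apply hkeep
    unfold Later
    omega
  · refine ⟨by simpa using h1, by simpa using h2, by simpa using h3, rfl, hc, by simp; omega,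
      by simp; omega, ?_⟩
    simp only [Function.update_apply, Nat.reduceEqDiff, reduceIte]
    have hl : Later M p r := ⟨hv.symm, by unfold Before; omega⟩
    refine Or.inr ⟨⟨c, by omega, hr⟩, hl, ?_⟩
    refine hsucc (Q := fun x => Later M p x → ¬ Before M x r) ?_ (fun _ => by unfold Before; omega)
    intro i hi hli
    rcases h8 with ⟨g1, g2⟩ | ⟨⟨k', hk', hfk⟩, g2, g3⟩
    · exact absurd hli (g2 i hi)
    · have := g3 i hi hli
      unfold Before at this ⊢
      omega
  · refine ⟨by simpa using h1, by simpa using h2, by simpa using h3, rfl, hc, by simp; omega,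
      by simp; omega, ?_⟩
    simp only [Function.update_apply, Nat.reduceEqDiff, reduceIte, ← hf]
    apply hkeep
    unfold Later Before
    omega

theorem eval_nodeCount {σ : State} {m : ℕ} (h : σ.mem 1 = m) :
    nodeCount.eval σ = 3 * m + 1 := by
  simp only [nodeCount, Expr.eval, h]
  ring

theorem scan_spec {W b p₀ m p k : ℕ} {M : ℕ → ℕ} {σ : State} (hs : Sizes W b)
    (hσ : Bounded b σ) (hb : p₀ + 16 * (3 * m + 1) + 16 ≤ b) (hp0 : 0 < p₀)
    (hmem : σ.mem = M) (hm : M 1 = m)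
    (hsrc : σ.reg rSrc = p₀) (htail : σ.reg rTail = k) (hnode : σ.reg rNode = p) :
    Run W b scan (500 * m + 500) σ fun τ => τ.mem = M ∧ τ.reg rSrc = p₀ ∧ τ.reg rTail = k ∧
      τ.reg rNode = p ∧ ((τ.reg rFound = 0 ∧ ∀ r, IsNode p₀ (3 * m + 1) r → ¬ Later M p r) ∨
        IsNext p₀ (3 * m + 1) M p (τ.reg rFound)) := by
  refine Run.mono (Run.seq (T' := (3 * m + 1) * (scanStep.cost + 1 + 1) + (1 + 1))
    (Run.of_wp hs (by decide) hσ (Q := fun τ => Scan p₀ (3 * m + 1) p k M 0 τ) ?_) ?_) ?_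
    fun τ _ h => h
  · have e := eval_nodeCount (σ := ⟨Function.update (Function.update σ.reg 6 0) 7 p₀, σ.mem⟩)
      (m := m) (by rw [hmem]; exact hm)
    simp only [wp, Expr.eval, Function.update_of_ne, Nat.reduceEqDiff, ne_eq, not_false_eq_true,
      hsrc, e]
    exact ⟨by omega, by omega, by omega, hsrc, htail, hnode, hmem, by omega, rfl, rfl,
      Or.inl ⟨rfl, fun i hi => by omega⟩⟩
  · intro τ hτ hI
    refine Run.mono (Run.loop hs (e := .reg rEdge) (T := scanStep.cost) (P := scanStep) (by decide)
      (fun j τ => ∃ c, j = 3 * m + 1 - c ∧ Scan p₀ (3 * m + 1) p k M c τ) ?_ (3 * m + 1) τ hτ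
      ⟨0, by omega, hI⟩) le_rfl ?_
    · rintro j τ hτ ⟨c, rfl, h⟩ he
      simp only [Expr.eval, h.edge] at he
      refine ⟨3 * m + 1 - (c + 1), by omega, ?_⟩
      exact Run.mono (scanStep_spec hs hτ hb hp0 h (by omega)) le_rfl
        fun τ _ h => ⟨c + 1, rfl, h⟩
    · rintro τ hτ ⟨j, ⟨c, rfl, h⟩, he⟩
      simp only [Expr.eval, h.edge] at he
      have hc := h.le
      obtain rfl : c = 3 * m + 1 := by omega
      refine ⟨h.mem, h.src, h.tail, h.node, ?_⟩
      rcases h.best with ⟨h1, h2⟩ | ⟨⟨i, hi, h1⟩, h2, h3⟩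
      · refine Or.inl ⟨h1, ?_⟩
        rintro _ ⟨i, hi, rfl⟩
        exact h2 i hi
      · refine Or.inr ⟨⟨i, hi, h1⟩, h2, ?_⟩
        rintro _ ⟨i, hi, rfl⟩
        exact h3 i hi
  · simp only [Prog.cost, Expr.cost, scanStep, Expr.fld, nodeCount, Expr.ne, Expr.inf]
    omega

/-- Link the event at `rNode` with the next one at the same vertex. -/
def linkStep : Prog :=
  .seq scan <|
  .seq (.ite (.reg rFound)
    (.seq (.store (.reg rNode) (.reg rFound)) <|
      .seq (.store (.add (.reg rNode) (.lit 4)) (.add (.load (.lit 1)) (.lit 1))) <|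
      .seq (.store (.add (.reg rNode) (.lit 8)) (.add (.reg rFound) (.lit 1))) <|
      .seq (.store (.add (.reg rFound) (.lit 1)) (.reg rNode)) <|
      .store (.add (.reg rFound) (.lit 9)) (.reg rNode)) .skip) <|
  .seq (.assign rNode (.add (.reg rNode) (.lit 16))) (.assign rTail (.sub (.reg rTail) (.lit 1)))

/-- The memory `M` after the first `c` events were linked, if it was `R` before. -/
structure Linked (p₀ N K : ℕ) (R : ℕ → ℕ) (c : ℕ) (M : ℕ → ℕ) : Prop where
  same : ∀ a, a < p₀ ∨ (a % 16 ≠ 0 ∧ a % 16 ≠ 1 ∧ a % 16 ≠ 4 ∧ a % 16 ≠ 8 ∧ a % 16 ≠ 9) →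
    M a = R a
  linked : ∀ i < c, (M (p₀ + 16 * i) = 0 ∧ M (p₀ + 16 * i + 4) = 0 ∧
      ∀ r, IsNode p₀ N r → ¬ Later R (p₀ + 16 * i) r) ∨
    ∃ r, IsNext p₀ N R (p₀ + 16 * i) r ∧ M (p₀ + 16 * i) = r ∧ M (p₀ + 16 * i + 4) = K ∧
      M (p₀ + 16 * i + 8) = r + 1 ∧ M (r + 1) = p₀ + 16 * i ∧ M (r + 9) = p₀ + 16 * i
  unlinked : ∀ i, c ≤ i → i < N → M (p₀ + 16 * i) = 0 ∧ M (p₀ + 16 * i + 4) = 0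
  back : ∀ i < N, M (p₀ + 16 * i + 1) ≠ 0 → ∃ j < c, M (p₀ + 16 * j) = p₀ + 16 * i

theorem Linked.later_iff {p₀ N K c p r : ℕ} {R M : ℕ → ℕ} (h : Linked p₀ N K R c M)
    (hd : p₀ % 16 = 0) (hp : IsNode p₀ N p) (hr : IsNode p₀ N r) :
    (Later M p r ↔ Later R p r) ∧ (Before M p r ↔ Before R p r) := by
  obtain ⟨i, hi, rfl⟩ := hp
  obtain ⟨j, hj, rfl⟩ := hr
  unfold Later Before
  rw [h.same _ (by omega), h.same _ (by omega), h.same _ (by omega), h.same _ (by omega)]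
  exact ⟨Iff.rfl, Iff.rfl⟩

theorem Linked.next_iff {p₀ N K c p r : ℕ} {R M : ℕ → ℕ} (h : Linked p₀ N K R c M)
    (hd : p₀ % 16 = 0) (hp : IsNode p₀ N p) : IsNext p₀ N M p r ↔ IsNext p₀ N R p r := by
  constructor
  · rintro ⟨h1, h2, h3⟩
    exact ⟨h1, (h.later_iff hd hp h1).1.1 h2, fun r' hr' hl =>
      mt (h.later_iff hd hr' h1).2.2 (h3 r' hr' ((h.later_iff hd hp hr').1.2 hl))⟩
  · rintro ⟨h1, h2, h3⟩
    exact ⟨h1, (h.later_iff hd hp h1).1.2 h2, fun r' hr' hl =>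
      mt (h.later_iff hd hr' h1).2.1 (h3 r' hr' ((h.later_iff hd hp hr').1.1 hl))⟩

theorem linkStep_spec {W b p₀ m c : ℕ} {R : ℕ → ℕ} {σ : State} (hs : Sizes W b)
    (hσ : Bounded b σ) (hp : p₀ = 16 * (m + 1)) (hb : p₀ + 16 * (3 * m + 1) + 100 ≤ b)
    (hm : R 1 = m) (hsrc : σ.reg rSrc = p₀) (htail : σ.reg rTail = 3 * m + 1 - c)
    (hnode : σ.reg rNode = p₀ + 16 * c) (hc : c < 3 * m + 1)
    (hL : Linked p₀ (3 * m + 1) (m + 1) R c σ.mem) :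
    Run W b linkStep (500 * m + 600) σ fun τ => τ.reg rSrc = p₀ ∧
      τ.reg rTail = 3 * m + 1 - (c + 1) ∧ τ.reg rNode = p₀ + 16 * (c + 1) ∧
      Linked p₀ (3 * m + 1) (m + 1) R (c + 1) τ.mem := by
  have hm' : σ.mem 1 = m := (hL.same 1 (by omega)).trans hm
  have hd : p₀ % 16 = 0 := by omega
  have hnp : IsNode p₀ (3 * m + 1) (p₀ + 16 * c) := ⟨c, hc, rfl⟩
  refine Run.mono (Run.seq (T' := 100) (scan_spec hs hσ (by omega) (by omega) rfl hm' hsrc htail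
    hnode) ?_) (by omega) fun _ _ h => h
  rintro τ hτ ⟨h1, h2, h3, h4, h5⟩
  refine Run.mono (Run.of_wp hs (by decide) hτ (Q := _) ?_) (by decide) fun _ _ h => h
  obtain ⟨f, hf⟩ : ∃ f, f = τ.reg rFound := ⟨_, rfl⟩
  rw [← hf] at h5
  obtain ⟨M, hM⟩ : ∃ M, σ.mem = M := ⟨_, rfl⟩
  rw [hM] at h1 h5 hL hm'
  simp only [wp, ne_eq, Expr.eval, h1, h3, h4, ← hf, Function.update_of_ne, Nat.reduceEqDiff,
    not_false_eq_true]
  constructor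
  · intro hf0
    have hnext := (hL.next_iff hd hnp).1 (h5.resolve_left fun h => hf0 h.1)
    obtain ⟨⟨r, hr, rfl⟩, hl, -⟩ := id hnext
    have hrc : r ≠ c := by
      rintro rfl
      have := hl.2
      unfold Before at this
      omega
    -- By `IsNext.injective` no earlier event was linked to `r`, so writing its slot 1 destroys no
    -- link.
    have hunset : ∀ i < c, M (p₀ + 16 * i) ≠ p₀ + 16 * r := by
      intro i hi hir
      rcases hL.linked i hi with h | ⟨r', g1, g2, -⟩
      · omega
      · rw [← g2, hir] at g1
        have := hnext.injective hnp ⟨i, by omega, rfl⟩ g1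
        omega
    rw [Function.update_of_ne (by omega), hm']
    refine ⟨by omega, by omega, by omega, by omega, by omega, by omega, by omega, h2, by simp; omega,
      rfl, ?_⟩
    obtain ⟨M', hM'⟩ : ∃ M', M' = Function.update (Function.update (Function.update
      (Function.update (Function.update M (p₀ + 16 * c) (p₀ + 16 * r)) (p₀ + 16 * c + 4) (m + 1))
      (p₀ + 16 * c + 8) (p₀ + 16 * r + 1)) (p₀ + 16 * r + 1) (p₀ + 16 * c)) (p₀ + 16 * r + 9)
      (p₀ + 16 * c) := ⟨_, rfl⟩
    rw [← hM']
    have hrest : ∀ a, a ≠ p₀ + 16 * c → a ≠ p₀ + 16 * c + 4 → a ≠ p₀ + 16 * c + 8 →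
        a ≠ p₀ + 16 * r + 1 → a ≠ p₀ + 16 * r + 9 → M' a = M a := by
      intro a i1 i2 i3 i4 i5
      rw [hM', Function.update_of_ne i5, Function.update_of_ne i4, Function.update_of_ne i3,
        Function.update_of_ne i2, Function.update_of_ne i1]
    have k1 : M' (p₀ + 16 * c) = p₀ + 16 * r := by
      rw [hM']
      iterate 4 rw [Function.update_of_ne (by omega)]
      rw [Function.update_self]
    have k2 : M' (p₀ + 16 * c + 4) = m + 1 := by
      rw [hM']
      iterate 3 rw [Function.update_of_ne (by omega)]
      rw [Function.update_self]
    have k3 : M' (p₀ + 16 * c + 8) = p₀ + 16 * r + 1 := by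
      rw [hM']
      iterate 2 rw [Function.update_of_ne (by omega)]
      rw [Function.update_self]
    have k4 : M' (p₀ + 16 * r + 1) = p₀ + 16 * c := by
      rw [hM', Function.update_of_ne (by omega), Function.update_self]
    have k5 : M' (p₀ + 16 * r + 9) = p₀ + 16 * c := by
      rw [hM', Function.update_self]
    refine ⟨fun a ha => ?_, fun i hi => ?_, fun i hi hiN => ?_, fun i hi => ?_⟩
    · rw [← hL.same a ha]
      exact hrest a (by omega) (by omega) (by omega) (by omega) (by omega)
    · by_cases hic : i = c
      · subst hic
        exact Or.inr ⟨_, hnext, k1, k2, k3, k4, k5⟩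
      · rcases hL.linked i (by omega) with ⟨g1, g2, g3⟩ | ⟨r', g1, g2, g3, g4, g5, g6⟩
        · refine Or.inl ⟨?_, ?_, g3⟩
          · rw [hrest _ (by omega) (by omega) (by omega) (by omega) (by omega), g1]
          · rw [hrest _ (by omega) (by omega) (by omega) (by omega) (by omega), g2]
        · obtain ⟨r', hr', rfl⟩ := id g1.node
          have := hunset i (by omega)
          rw [g2] at this
          refine Or.inr ⟨_, g1, ?_, ?_, ?_, ?_, ?_⟩
          · rw [hrest _ (by omega) (by omega) (by omega) (by omega) (by omega), g2]
          · rw [hrest _ (by omega) (by omega) (by omega) (by omega) (by omega), g3]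
          · rw [hrest _ (by omega) (by omega) (by omega) (by omega) (by omega), g4]
          · rw [hrest _ (by omega) (by omega) (by omega) (by omega) (by omega), g5]
          · rw [hrest _ (by omega) (by omega) (by omega) (by omega) (by omega), g6]
    · rw [hrest _ (by omega) (by omega) (by omega) (by omega) (by omega),
        hrest _ (by omega) (by omega) (by omega) (by omega) (by omega)]
      exact hL.unlinked i (by omega) hiN
    · by_cases hir : i = r
      · subst hir
        exact fun _ => ⟨c, by omega, k1⟩
      · rw [hrest _ (by omega) (by omega) (by omega) (by omega) (by omega)]
        intro hne
        obtain ⟨j, hj, hji⟩ := hL.back i hi hne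
        refine ⟨j, by omega, ?_⟩
        rw [hrest _ (by omega) (by omega) (by omega) (by omega) (by omega), hji]
  · intro hf0
    have hnone : ∀ r, IsNode p₀ (3 * m + 1) r → ¬ Later R (p₀ + 16 * c) r := by
      rcases h5 with ⟨-, h5⟩ | h5
      · exact fun r hr => mt (hL.later_iff hd hnp hr).1.2 (h5 r hr)
      · obtain ⟨r, hr, hfr⟩ := h5.node
        omega
    refine ⟨by omega, by omega, h2, by simp; omega, rfl, hL.same, fun i hi => ?_,
      fun i hi => hL.unlinked i (by omega), fun i hi hne => ?_⟩
    · by_cases hic : i = c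
      · subst hic
        have := hL.unlinked i le_rfl hc
        exact Or.inl ⟨this.1, this.2, hnone⟩
      · exact hL.linked i (by omega)
    · obtain ⟨j, hj, hji⟩ := hL.back i hi hne
      exact ⟨j, by omega, hji⟩

/-- Link all events. -/
def link : Prog :=
  .seq (.seq (.assign rNode (.reg rSrc)) (.assign rTail nodeCount)) <| .while (.reg rTail) linkStep

theorem link_spec {W b p₀ m : ℕ} {R : ℕ → ℕ} {σ : State} (hs : Sizes W b)
    (hσ : Bounded b σ) (hp : p₀ = 16 * (m + 1)) (hb : p₀ + 16 * (3 * m + 1) + 100 ≤ b)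
    (hm : R 1 = m) (hsrc : σ.reg rSrc = p₀) (hL : Linked p₀ (3 * m + 1) (m + 1) R 0 σ.mem) :
    Run W b link ((3 * m + 1) * (500 * m + 602) + 20) σ fun τ => τ.reg rSrc = p₀ ∧
      Linked p₀ (3 * m + 1) (m + 1) R (3 * m + 1) τ.mem := by
  have hm' : σ.mem 1 = m := (hL.same 1 (by omega)).trans hm
  refine Run.mono (Run.seq (T' := (3 * m + 1) * (500 * m + 600 + 1 + 1) + (1 + 1))
    (Run.of_wp hs (by decide) hσ (Q := fun τ => τ.reg rSrc = p₀ ∧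
      τ.reg rTail = 3 * m + 1 - 0 ∧ τ.reg rNode = p₀ + 16 * 0 ∧
      Linked p₀ (3 * m + 1) (m + 1) R 0 τ.mem) ?_) ?_) ?_ fun τ _ h => h
  · have e := eval_nodeCount (σ := ⟨Function.update σ.reg 5 p₀, σ.mem⟩) (m := m) hm'
    simp only [wp, Expr.eval, hsrc, e]
    exact ⟨by omega, by omega, hsrc, rfl, rfl, hL⟩
  · intro τ hτ hI
    refine Run.mono (Run.loop hs (e := .reg rTail) (T := 500 * m + 600) (P := linkStep) (by decide)
      (fun j τ => ∃ c ≤ 3 * m + 1, j = 3 * m + 1 - c ∧ τ.reg rSrc = p₀ ∧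
        τ.reg rTail = 3 * m + 1 - c ∧ τ.reg rNode = p₀ + 16 * c ∧
        Linked p₀ (3 * m + 1) (m + 1) R c τ.mem) ?_ (3 * m + 1) τ hτ
      ⟨0, by omega, by omega, hI⟩) le_rfl ?_
    · rintro j τ hτ ⟨c, hc, rfl, h1, h2, h3, h4⟩ he
      simp only [Expr.eval, h2] at he
      refine ⟨3 * m + 1 - (c + 1), by omega, ?_⟩
      exact Run.mono (linkStep_spec hs hτ hp hb hm h1 h2 h3 (by omega) h4) le_rfl
        fun τ _ h => ⟨c + 1, by omega, rfl, h⟩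
    · rintro τ hτ ⟨j, ⟨c, hc, rfl, h1, h2, h3, h4⟩, he⟩
      simp only [Expr.eval, h2] at he
      obtain rfl : c = 3 * m + 1 := by omega
      exact ⟨h1, h4⟩
  · simp only [Prog.cost, Expr.cost, nodeCount]
    ring_nf
    omega

/-! ### The network of the events -/

/-- The memory `M` holds the network of the events of the time arcs in the input `w`: the record
of the source is at `p₀`, and those of the arrival, the delayed arrival and the departure of the
`i`-th time arc are at `p₀ + 16 + 48 * i`, `p₀ + 32 + 48 * i` and `p₀ + 48 + 48 * i`. -/
structure Events (p₀ m : ℕ) (w M : ℕ → ℕ) : Prop where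
  net : Net p₀ (3 * m + 1) (m + 1) M
  input : ∀ a < p₀, M a = w a
  mark : ∀ p, IsNode p₀ (3 * m + 1) p → M (p + 12) = 0
  source_vertex : M (p₀ + 15) = w 2
  source_key : M (p₀ + 13) = 0
  source_cap : M (p₀ + 6) = 0 ∧ M (p₀ + 7) = 0
  vertex : ∀ i < m, M (p₀ + 16 + 48 * i + 15) = w (6 + 4 * i + 1) ∧
    M (p₀ + 32 + 48 * i + 15) = w (6 + 4 * i + 1) ∧ M (p₀ + 48 + 48 * i + 15) = w (6 + 4 * i)
  key : ∀ i < m, M (p₀ + 16 + 48 * i + 13) = 2 * (w (6 + 4 * i + 2) + w (6 + 4 * i + 3)) ∧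
    M (p₀ + 32 + 48 * i + 13) = 2 * (w (6 + 4 * i + 2) + w (6 + 4 * i + 3) + w 5) ∧
    M (p₀ + 48 + 48 * i + 13) = 2 * w (6 + 4 * i + 2) + 1
  arrival : ∀ i < m, M (p₀ + 48 + 48 * i + 2) = p₀ + 16 + 48 * i ∧ M (p₀ + 48 + 48 * i + 6) = 1
  delayed : ∀ i < m, M (p₀ + 48 + 48 * i + 3) = p₀ + 32 + 48 * i ∧
    M (p₀ + 48 + 48 * i + 7) = m + 1
  reverse_cap : ∀ i < m, M (p₀ + 16 + 48 * i + 6) = 0 ∧ M (p₀ + 16 + 48 * i + 7) = 0 ∧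
    M (p₀ + 32 + 48 * i + 6) = 0 ∧ M (p₀ + 32 + 48 * i + 7) = 0
  back_cap : ∀ p, IsNode p₀ (3 * m + 1) p → M (p + 5) = 0
  next : ∀ p, IsNode p₀ (3 * m + 1) p →
    (M (p + 4) = 0 ∧ ∀ r, IsNode p₀ (3 * m + 1) r → ¬ Later M p r) ∨
      IsNext p₀ (3 * m + 1) M p (M p) ∧ M (p + 4) = m + 1

theorem isNode_cases {p₀ m p : ℕ} (hp : IsNode p₀ (3 * m + 1) p) :
    p = p₀ ∨ ∃ i < m, p = p₀ + 16 + 48 * i ∨ p = p₀ + 32 + 48 * i ∨ p = p₀ + 48 + 48 * i := by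
  obtain ⟨j, hj, rfl⟩ := hp
  rcases Nat.eq_zero_or_pos j with rfl | h
  · exact Or.inl rfl
  · exact Or.inr ⟨(j - 1) / 3, by omega, by omega⟩

theorem isNode_source (p₀ m : ℕ) : IsNode p₀ (3 * m + 1) p₀ := ⟨0, by omega, rfl⟩

theorem isNode_event {p₀ m i : ℕ} (hi : i < m) :
    IsNode p₀ (3 * m + 1) (p₀ + 16 + 48 * i) ∧ IsNode p₀ (3 * m + 1) (p₀ + 32 + 48 * i) ∧
      IsNode p₀ (3 * m + 1) (p₀ + 48 + 48 * i) :=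
  ⟨⟨3 * i + 1, by omega, by omega⟩, ⟨3 * i + 2, by omega, by omega⟩,
    ⟨3 * i + 3, by omega, by omega⟩⟩

theorem Records.cell {p₀ m i : ℕ} {w M : ℕ → ℕ} (h : Records p₀ w m M) (hi : i < m) {k x a : ℕ}
    (hk : k < 48) (ha : a = p₀ + 16 + 48 * i + k)
    (hx : arcRecord (p₀ + 16 + 48 * i) (w 1 + 1) (w (6 + 4 * i)) (w (6 + 4 * i + 1))
      (w (6 + 4 * i + 2)) (w (6 + 4 * i + 3)) (w 5) k = x) : M a = x := by
  rw [ha, h.arc i hi k hk, hx]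

theorem Records.zero {p₀ m : ℕ} {w M : ℕ → ℕ} (h : Records p₀ w m M) {k : ℕ}
    (hk : k = 0 ∨ k = 1 ∨ k = 4 ∨ k = 5 ∨ k = 12) {p : ℕ} (hp : IsNode p₀ (3 * m + 1) p) :
    M (p + k) = 0 := by
  rcases isNode_cases hp with rfl | ⟨i, hi, rfl | rfl | rfl⟩
  · exact h.source_zero k (by omega)
  · refine h.cell hi (k := k) (by omega) rfl ?_
    rcases hk with rfl | rfl | rfl | rfl | rfl <;> rfl
  · refine h.cell hi (k := 16 + k) (by omega) (by omega) ?_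
    rcases hk with rfl | rfl | rfl | rfl | rfl <;> rfl
  · refine h.cell hi (k := 32 + k) (by omega) (by omega) ?_
    rcases hk with rfl | rfl | rfl | rfl | rfl <;> rfl

theorem Records.linked {p₀ m : ℕ} {w M : ℕ → ℕ} (h : Records p₀ w m M) :
    Linked p₀ (3 * m + 1) (m + 1) M 0 M where
  same := fun _ _ => rfl
  linked := fun i hi => by omega
  unlinked := fun i _ hi => ⟨h.zero (k := 0) (by omega) ⟨i, hi, rfl⟩, h.zero (by omega) ⟨i, hi, rfl⟩⟩
  back := fun i hi hne => absurd (h.zero (by omega) ⟨i, hi, rfl⟩) hne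

/-- Linking uses slots 0 and 1 and the arc records use slots 2 and 3, so each edge is matched with
its reverse within one of the two groups. -/
theorem Linked.events {p₀ m : ℕ} {w R M : ℕ → ℕ} (hR : Records p₀ w m R)
    (hL : Linked p₀ (3 * m + 1) (m + 1) R (3 * m + 1) M) (hp : p₀ = 16 * (m + 1)) (hm : w 1 = m) :
    Events p₀ m w M := by
  have hd : p₀ % 16 = 0 := by omega
  have c5 : ∀ p, IsNode p₀ (3 * m + 1) p → M (p + 5) = 0 := by
    rintro p hpn
    have := hR.zero (k := 5) (by omega) hpn
    obtain ⟨i, hi, rfl⟩ := hpn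
    rw [hL.same _ (by omega), this]
  have c12 : ∀ p, IsNode p₀ (3 * m + 1) p → M (p + 12) = 0 := by
    rintro p hpn
    have := hR.zero (k := 12) (by omega) hpn
    obtain ⟨i, hi, rfl⟩ := hpn
    rw [hL.same _ (by omega), this]
  have cs : ∀ k < 16, (2 ≤ k ∧ k < 4 ∨ 6 ≤ k ∧ k < 8 ∨ 10 ≤ k) → M (p₀ + k) = R (p₀ + k) :=
    fun k hk hk' => hL.same _ (by omega)
  have ca : ∀ i < m, ∀ a k, k < 48 → a = p₀ + 16 + 48 * i + k →
      (2 ≤ k % 16 ∧ k % 16 < 4 ∨ 6 ≤ k % 16 ∧ k % 16 < 8 ∨ 10 ≤ k % 16) →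
      M a = arcRecord (p₀ + 16 + 48 * i) (m + 1) (w (6 + 4 * i))
        (w (6 + 4 * i + 1)) (w (6 + 4 * i + 2)) (w (6 + 4 * i + 3)) (w 5) k := by
    intro i hi a k hk ha hk'
    rw [hL.same _ (by omega), hR.cell hi hk ha rfl, hm]
  have arr : ∀ i < m, M (p₀ + 48 + 48 * i + 2) = p₀ + 16 + 48 * i ∧ M (p₀ + 48 + 48 * i + 6) = 1 :=
    fun i hi => ⟨ca i hi _ 34 (by omega) (by omega) (by omega),
      ca i hi _ 38 (by omega) (by omega) (by omega)⟩
  have del : ∀ i < m, M (p₀ + 48 + 48 * i + 3) = p₀ + 32 + 48 * i ∧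
      M (p₀ + 48 + 48 * i + 7) = m + 1 := fun i hi =>
    ⟨(ca i hi _ 35 (by omega) (by omega) (by omega)).trans
      (show p₀ + 16 + 48 * i + 16 = _ by omega), ca i hi _ 39 (by omega) (by omega) (by omega)⟩
  have rc : ∀ i < m, M (p₀ + 16 + 48 * i + 6) = 0 ∧ M (p₀ + 16 + 48 * i + 7) = 0 ∧
      M (p₀ + 32 + 48 * i + 6) = 0 ∧ M (p₀ + 32 + 48 * i + 7) = 0 := fun i hi =>
    ⟨ca i hi _ 6 (by omega) (by omega) (by omega), ca i hi _ 7 (by omega) (by omega) (by omega),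
      ca i hi _ 22 (by omega) (by omega) (by omega), ca i hi _ 23 (by omega) (by omega) (by omega)⟩
  have rd : ∀ i < m, M (p₀ + 16 + 48 * i + 2) = p₀ + 48 + 48 * i ∧ M (p₀ + 16 + 48 * i + 3) = 0 ∧
      M (p₀ + 32 + 48 * i + 2) = 0 ∧ M (p₀ + 32 + 48 * i + 3) = p₀ + 48 + 48 * i := fun i hi =>
    ⟨(ca i hi _ 2 (by omega) (by omega) (by omega)).trans
      (show p₀ + 16 + 48 * i + 32 = _ by omega), ca i hi _ 3 (by omega) (by omega) (by omega),
      ca i hi _ 18 (by omega) (by omega) (by omega), (ca i hi _ 19 (by omega) (by omega)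
      (by omega)).trans (show p₀ + 16 + 48 * i + 32 = _ by omega)⟩
  have rv : ∀ i < m, M (p₀ + 16 + 48 * i + 10) = p₀ + 48 + 48 * i + 2 ∧
      M (p₀ + 48 + 48 * i + 10) = p₀ + 16 + 48 * i + 2 ∧
      M (p₀ + 32 + 48 * i + 11) = p₀ + 48 + 48 * i + 3 ∧
      M (p₀ + 48 + 48 * i + 11) = p₀ + 32 + 48 * i + 3 := fun i hi =>
    ⟨(ca i hi _ 10 (by omega) (by omega) (by omega)).trans
      (show p₀ + 16 + 48 * i + 34 = _ by omega), ca i hi _ 42 (by omega) (by omega) (by omega),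
      (ca i hi _ 27 (by omega) (by omega) (by omega)).trans
      (show p₀ + 16 + 48 * i + 35 = _ by omega), (ca i hi _ 43 (by omega) (by omega)
      (by omega)).trans (show p₀ + 16 + 48 * i + 19 = _ by omega)⟩
  have s0 : M (p₀ + 2) = 0 ∧ M (p₀ + 3) = 0 ∧ M (p₀ + 6) = 0 ∧ M (p₀ + 7) = 0 ∧ M (p₀ + 13) = 0 :=
    ⟨(cs 2 (by omega) (by omega)).trans (hR.source_zero 2 (by omega)),
      (cs 3 (by omega) (by omega)).trans (hR.source_zero 3 (by omega)),
      (cs 6 (by omega) (by omega)).trans (hR.source_zero 6 (by omega)),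
      (cs 7 (by omega) (by omega)).trans (hR.source_zero 7 (by omega)),
      (cs 13 (by omega) (by omega)).trans (hR.source_zero 13 (by omega))⟩
  have bk : ∀ p, IsNode p₀ (3 * m + 1) p → M (p + 1) ≠ 0 → IsNode p₀ (3 * m + 1) (M (p + 1)) ∧
      M (M (p + 1)) = p ∧ M (M (p + 1) + 4) = m + 1 ∧ M (M (p + 1) + 8) = p + 1 ∧
      M (p + 9) = M (p + 1) := by
    rintro _ ⟨i, hi, rfl⟩ hne
    obtain ⟨j, hj, hji⟩ := hL.back i hi hne
    rcases hL.linked j hj with h | ⟨r, h1, h2, h3, h4, h5, h6⟩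
    · omega
    · obtain rfl := h2.symm.trans hji
      rw [h5]
      exact ⟨⟨j, hj, rfl⟩, hji, h3, h4, h6⟩
  refine ⟨⟨by omega, hd, ?_, ?_⟩, ?_, c12, ?_, s0.2.2.2.2, ⟨s0.2.2.1, s0.2.2.2.1⟩, ?_, ?_, arr, del,
    rc, c5, ?_⟩
  · intro p hpn j hj h0
    have hj' : j = 0 ∨ j = 1 ∨ j = 2 ∨ j = 3 := by omega
    rcases hj' with rfl | rfl | rfl | rfl
    · obtain ⟨i, hi, rfl⟩ := hpn
      rcases hL.linked i hi with h | ⟨r, h1, h2, -⟩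
      · exact h.2.1
      · obtain ⟨k, hk, rfl⟩ := h1.node
        rw [add_zero] at h0
        omega
    · exact c5 p hpn
    · rcases isNode_cases hpn with rfl | ⟨i, hi, rfl | rfl | rfl⟩
      · exact s0.2.2.1
      · exact (rc i hi).1
      · exact (rc i hi).2.2.1
      · have := (arr i hi).1
        omega
    · rcases isNode_cases hpn with rfl | ⟨i, hi, rfl | rfl | rfl⟩
      · exact s0.2.2.2.1
      · exact (rc i hi).2.1
      · exact (rc i hi).2.2.2
      · have := (del i hi).1
        omega
  · intro p hpn j hj h0
    have hj' : j = 0 ∨ j = 1 ∨ j = 2 ∨ j = 3 := by omega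
    rcases hj' with rfl | rfl | rfl | rfl
    · obtain ⟨i, hi, rfl⟩ := hpn
      rcases hL.linked i hi with h | ⟨r, h1, h2, h3, h4, h5, h6⟩
      · exact absurd h.1 h0
      · refine ⟨r, h1.node, 1, by omega, h2, h4, h5, h6, ?_, ?_⟩
        · obtain ⟨k, hk, rfl⟩ := h1.node
          omega
        · rw [add_zero, h3, add_assoc, c5 r h1.node]
    · obtain ⟨h1, h2, h3, h4, h5⟩ := bk p hpn h0
      refine ⟨_, h1, 0, by omega, rfl, h5, h2, h4, ?_, ?_⟩
      · obtain ⟨i, hi, hi'⟩ := h1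
        obtain ⟨k, hk, rfl⟩ := hpn
        omega
      · have := c5 p hpn
        simp only [add_assoc, Nat.reduceAdd, add_zero] at *
        omega
    · rcases isNode_cases hpn with rfl | ⟨i, hi, rfl | rfl | rfl⟩
      · exact absurd s0.1 h0
      · refine ⟨_, (isNode_event hi).2.2, 2, by omega, (rd i hi).1, (rv i hi).1, (arr i hi).1,
          (rv i hi).2.1, by omega, ?_⟩
        have h1 := (rc i hi).1
        have h2 := (arr i hi).2
        simp only [add_assoc, Nat.reduceAdd] at *
        omega
      · exact absurd (rd i hi).2.2.1 h0
      · refine ⟨_, (isNode_event hi).1, 2, by omega, (arr i hi).1, (rv i hi).2.1, (rd i hi).1,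
          (rv i hi).1, by omega, ?_⟩
        have h1 := (rc i hi).1
        have h2 := (arr i hi).2
        simp only [add_assoc, Nat.reduceAdd] at *
        omega
    · rcases isNode_cases hpn with rfl | ⟨i, hi, rfl | rfl | rfl⟩
      · exact absurd s0.2.1 h0
      · exact absurd (rd i hi).2.1 h0
      · refine ⟨_, (isNode_event hi).2.2, 3, by omega, (rd i hi).2.2.2, (rv i hi).2.2.1,
          (del i hi).1, (rv i hi).2.2.2, by omega, ?_⟩
        have h1 := (rc i hi).2.2.2
        have h2 := (del i hi).2
        simp only [add_assoc, Nat.reduceAdd] at *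
        omega
      · refine ⟨_, (isNode_event hi).2.1, 3, by omega, (del i hi).1, (rv i hi).2.2.2,
          (rd i hi).2.2.2, (rv i hi).2.2.1, by omega, ?_⟩
        have h1 := (rc i hi).2.2.2
        have h2 := (del i hi).2
        simp only [add_assoc, Nat.reduceAdd] at *
        omega
  · intro a ha
    rw [hL.same a (Or.inl ha), hR.input a ha]
  · rw [cs 15 (by omega) (by omega), hR.source]
  · exact fun i hi => ⟨ca i hi _ 15 (by omega) (by omega) (by omega),
      ca i hi _ 31 (by omega) (by omega) (by omega), ca i hi _ 47 (by omega) (by omega) (by omega)⟩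
  · exact fun i hi => ⟨(ca i hi _ 13 (by omega) (by omega) (by omega)).trans (two_mul _).symm,
      (ca i hi _ 29 (by omega) (by omega) (by omega)).trans (two_mul _).symm,
      (ca i hi _ 45 (by omega) (by omega) (by omega)).trans
        (congrArg (· + 1) (two_mul _).symm)⟩
  · intro p hpn
    obtain ⟨i, hi, rfl⟩ := id hpn
    rcases hL.linked i hi with h | ⟨r, h1, h2, h3, -⟩
    · exact Or.inl ⟨h.2.1, fun r hr => mt (hL.later_iff hd hpn hr).1.1 (h.2.2 r hr)⟩
    · rw [h2]
      exact Or.inr ⟨(hL.next_iff hd hpn).2 h1, h3⟩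

/-- Following waiting edges from `p` reaches every later event at its vertex: no step jumps over
`r`, and the number of events after the current one drops. Thus linearly many waiting edges
represent all waiting. -/
theorem Events.later_mem {p₀ m : ℕ} {w M : ℕ → ℕ} (h : Events p₀ m w M) {S : Set ℕ}
    (hS : ∀ p, IsNode p₀ (3 * m + 1) p → p ∈ S → M (p + 4) = m + 1 → M p ∈ S) {p r : ℕ}
    (hp : IsNode p₀ (3 * m + 1) p) (hr : IsNode p₀ (3 * m + 1) r) (hl : Later M p r)
    (hpS : p ∈ S) : r ∈ S := by
  classical
  obtain ⟨n, hn⟩ : ∃ n, n = Finset.card {i ∈ Finset.range (3 * m + 1) | Before M p (p₀ + 16 * i)} :=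
    ⟨_, rfl⟩
  induction n using Nat.strong_induction_on generalizing p with
  | _ n ih =>
    rcases h.next p hp with ⟨-, h1⟩ | ⟨h1, h2⟩
    · exact absurd hl (h1 r hr)
    · have hnS := hS p hp hpS h2
      by_cases hrn : M p = r
      · rwa [← hrn]
      · have h3 := h1.first r hr hl
        have h4 : Later M (M p) r := by
          refine ⟨h1.later.1.symm.trans hl.1, ?_⟩
          unfold Before at h3 ⊢
          omega
        refine ih _ ?_ h1.node h4 hnS rfl
        rw [hn]
        apply Finset.card_lt_card
        have hpn := h1.later.2
        obtain ⟨k, hk, hkn⟩ := h1.node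
        refine ⟨fun i hi => ?_, fun hsub => ?_⟩
        · simp only [Finset.mem_filter] at hi ⊢
          refine ⟨hi.1, ?_⟩
          have := hi.2
          unfold Before at this hpn ⊢
          omega
        · have hmem := hsub (Finset.mem_filter.2 ⟨Finset.mem_range.2 hk, hkn ▸ hpn⟩)
          simp only [Finset.mem_filter, ← hkn] at hmem
          have := hmem.2
          unfold Before at this
          omega

/-- Small cuts are closed under waiting and under delayed arrivals. -/
theorem Events.of_cutCap_le {p₀ m : ℕ} {w M : ℕ → ℕ} (h : Events p₀ m w M) {S : Set ℕ}
    (hS : cutCap p₀ (3 * m + 1) M S ≤ m) :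
    (∀ p r, IsNode p₀ (3 * m + 1) p → IsNode p₀ (3 * m + 1) r → Later M p r → p ∈ S → r ∈ S) ∧
    ∀ i < m, p₀ + 48 + 48 * i ∈ S → p₀ + 32 + 48 * i ∈ S := by
  classical
  have key : ∀ p, IsNode p₀ (3 * m + 1) p → ∀ j < 4, p ∈ S → M (p + j + 4) = m + 1 →
      M (p + j) ∈ S := by
    rintro _ ⟨i, hi, rfl⟩ j hj hpS hc
    by_contra hne
    -- A single edge of capacity `m + 1` in the cut already exceeds the bound `m`.
    have h1 := Finset.single_le_sum (f := fun x : ℕ × ℕ =>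
      if p₀ + 16 * x.1 ∈ S ∧ M (p₀ + 16 * x.1 + x.2) ∉ S then M (p₀ + 16 * x.1 + x.2 + 4) else 0)
      (s := Finset.range (3 * m + 1) ×ˢ Finset.range 4) (fun _ _ => Nat.zero_le _) (a := (i, j))
      (by simp only [Finset.mem_product, Finset.mem_range]; exact ⟨hi, hj⟩)
    simp only [hpS, hne, not_false_eq_true, and_self, if_true, hc] at h1
    have h2 := h1.trans hS
    omega
  refine ⟨fun p r hp hr hl hpS => h.later_mem (fun p hp hpS hc => key p hp 0 (by omega) hpS hc)
    hp hr hl hpS, fun i hi hiS => ?_⟩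
  have := key _ (isNode_event hi).2.2 3 (by omega) hiS (h.delayed i hi).2
  rwa [(h.delayed i hi).1] at this

/-- The index of the edge from the departure to the arrival of a time arc. -/
def arrivalEdge : ℕ ↪ ℕ × ℕ :=
  ⟨fun i => (3 * i + 3, 2), fun i j hij => by
    simp only [Prod.mk.injEq] at hij
    omega⟩

theorem arrivalEdge_apply (i : ℕ) : arrivalEdge i = (3 * i + 3, 2) := rfl

open Classical in
theorem Events.card_le_cutCap {p₀ m : ℕ} {w M : ℕ → ℕ} (h : Events p₀ m w M) (S : Set ℕ) :
    Finset.card {i ∈ Finset.range m | p₀ + 48 + 48 * i ∈ S ∧ p₀ + 16 + 48 * i ∉ S} ≤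
      cutCap p₀ (3 * m + 1) M S := by
  rw [← Finset.card_map arrivalEdge, Finset.card_eq_sum_ones, cutCap]
  -- The source has index 0 and arc `i` occupies indices `3 * i + 1` to `3 * i + 3`, its departure
  -- being the last.
  have hpos : ∀ i, p₀ + 16 * (3 * i + 3) = p₀ + 48 + 48 * i := fun i => by omega
  refine le_trans (Finset.sum_le_sum ?_) (Finset.sum_le_sum_of_subset ?_)
  · intro x hx
    simp only [Finset.mem_map, Finset.mem_filter, Finset.mem_range] at hx
    obtain ⟨i, ⟨hi, h1, h2⟩, rfl⟩ := hx
    simp only [arrivalEdge_apply, hpos, (h.arrival i hi).1]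
    rw [if_pos ⟨h1, h2⟩]
    exact (h.arrival i hi).2.ge
  · intro x hx
    simp only [Finset.mem_map, Finset.mem_filter, Finset.mem_range] at hx
    obtain ⟨i, ⟨hi, h1, h2⟩, rfl⟩ := hx
    simp only [arrivalEdge_apply, Finset.mem_product, Finset.mem_range]
    omega

/-- The closure conditions keep all edges of capacity `m + 1` out of the cut, and reverse edges have
capacity 0 initially. What remains are the unit edges of arcs indexed by `J`. -/
theorem Events.cutCap_le_card {p₀ m : ℕ} {w M : ℕ → ℕ} (h : Events p₀ m w M) {S : Set ℕ}
    (hlater : ∀ p r, IsNode p₀ (3 * m + 1) p → IsNode p₀ (3 * m + 1) r → Later M p r →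
      p ∈ S → r ∈ S)
    (hdel : ∀ i < m, p₀ + 48 + 48 * i ∈ S → p₀ + 32 + 48 * i ∈ S) {J : Finset ℕ}
    (hJ : ∀ i < m, p₀ + 48 + 48 * i ∈ S → p₀ + 16 + 48 * i ∉ S → i ∈ J) :
    cutCap p₀ (3 * m + 1) M S ≤ J.card := by
  classical
  rw [← Finset.card_map arrivalEdge, Finset.card_eq_sum_ones, cutCap]
  have hterm : ∀ p, IsNode p₀ (3 * m + 1) p → ∀ j < 4, p ∈ S → M (p + j) ∉ S →
      M (p + j + 4) = 0 ∨ M (p + j + 4) = 1 ∧ ∃ i < m, i ∈ J ∧ p = p₀ + 48 + 48 * i ∧ j = 2 := by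
    intro p hp j hj hpS hnS
    have hj' : j = 0 ∨ j = 1 ∨ j = 2 ∨ j = 3 := by omega
    rcases hj' with rfl | rfl | rfl | rfl
    · rcases h.next p hp with h1 | h1
      · exact Or.inl h1.1
      · exact absurd (hlater _ _ hp h1.1.node h1.1.later hpS) hnS
    · exact Or.inl (h.back_cap p hp)
    · rcases isNode_cases hp with rfl | ⟨i, hi, rfl | rfl | rfl⟩
      · exact Or.inl h.source_cap.1
      · exact Or.inl (h.reverse_cap i hi).1
      · exact Or.inl (h.reverse_cap i hi).2.2.1
      · rw [(h.arrival i hi).1] at hnS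
        exact Or.inr ⟨(h.arrival i hi).2, i, hi, hJ i hi hpS hnS, rfl, rfl⟩
    · rcases isNode_cases hp with rfl | ⟨i, hi, rfl | rfl | rfl⟩
      · exact Or.inl h.source_cap.2
      · exact Or.inl (h.reverse_cap i hi).2.1
      · exact Or.inl (h.reverse_cap i hi).2.2.2
      · rw [(h.delayed i hi).1] at hnS
        exact absurd (hdel i hi hpS) hnS
  calc _ ≤ ∑ x ∈ Finset.range (3 * m + 1) ×ˢ Finset.range 4, if x ∈ J.map arrivalEdge then 1 else 0 := by
        refine Finset.sum_le_sum ?_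
        rintro ⟨i, j⟩ hx
        simp only [Finset.mem_product, Finset.mem_range] at hx
        split_ifs with h1 h2 h2
        · rcases hterm _ ⟨i, hx.1, rfl⟩ j hx.2 h1.1 h1.2 with h3 | h3
          · simp only at h3 ⊢
            omega
          · exact h3.1.le
        · rcases hterm _ ⟨i, hx.1, rfl⟩ j hx.2 h1.1 h1.2 with h3 | ⟨-, k, hk, hkJ, h4, rfl⟩
          · exact h3.le
          · refine absurd (Finset.mem_map.2 ⟨k, hkJ, ?_⟩) h2
            simp only [arrivalEdge_apply, Prod.mk.injEq, and_true]
            omega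
        · exact Nat.zero_le _
        · exact le_rfl
    _ ≤ _ := by
        rw [← Finset.sum_filter]
        refine Finset.sum_le_sum_of_subset fun x hx => ?_
        exact (Finset.mem_filter.1 hx).2

end WordRAM

/-! ### Reachability under delays -/

/-- One can arrive at a vertex by a given time, when the arcs in `D` are delayed. -/
inductive Arrives {V : Type*} [DecidableEq V] (G : TemporalGraph V) (δ : ℕ)
    (D : Finset (TimeArc V)) (s : V) : V → ℕ → Prop
  | start (τ : ℕ) : Arrives G δ D s s τ
  | step (e : TimeArc V) (τ : ℕ) (he : e ∈ G.arcs) (h : Arrives G δ D s e.src e.time)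
      (hτ : delayedArrival δ D e ≤ τ) : Arrives G δ D s e.dst τ

theorem Arrives.mono {V : Type*} [DecidableEq V] {G : TemporalGraph V} {δ : ℕ}
    {D : Finset (TimeArc V)} {s v : V} {τ τ' : ℕ} (h : Arrives G δ D s v τ) (hτ : τ ≤ τ') :
    Arrives G δ D s v τ' := by
  cases h with
  | start => exact .start τ'
  | step e _ he h h' => exact .step e τ' he h (h'.trans hτ)

theorem time_le_delayedArrival {V : Type*} [DecidableEq V] (δ : ℕ) (D : Finset (TimeArc V))
    (e : TimeArc V) : e.time ≤ delayedArrival δ D e :=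
  Nat.le_add_right _ _

theorem IsDelayedTemporalPath.of_append {V : Type*} [DecidableEq V] {G : TemporalGraph V} {δ : ℕ}
    {D : Finset (TimeArc V)} {s z : V} {p q : List (TimeArc V)} {f : TimeArc V}
    (h : IsDelayedTemporalPath G δ D s z (p ++ f :: q)) :
    IsDelayedTemporalPath G δ D s f.dst (p ++ [f]) := by
  have hpre : (p ++ [f]) <+: (p ++ f :: q) := ⟨q, by simp⟩
  refine ⟨⟨fun e he => h.mem_arcs e (hpre.subset he), fun e he => h.start e ?_, by simp, ?_⟩, ?_⟩
  · cases p <;> simpa using he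
  · exact h.chain.prefix hpre
  · exact h.nodup.sublist (hpre.sublist.map _ |>.cons_cons s)

/-- The path is extended arc by arc and cut back at a repeated vertex. The bound on all arrival
times is carried along because the earlier visit must also be in time for `τ`. -/
theorem Arrives.exists_path {V : Type*} [DecidableEq V] {G : TemporalGraph V} {δ : ℕ}
    {D : Finset (TimeArc V)} {s v : V} {τ : ℕ} (h : Arrives G δ D s v τ) :
    ∃ p, IsDelayedTemporalPath G δ D s v p ∧ ∀ e ∈ p, delayedArrival δ D e ≤ τ := by
  induction h with
  | start τ =>
    exact ⟨[], ⟨⟨by simp, by simp, by simp, by simp⟩, by simp⟩, by simp⟩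
  | step e τ he _ hτ ih =>
    obtain ⟨p, hp, hpt⟩ := ih
    have hpt' : ∀ f ∈ p, delayedArrival δ D f ≤ τ := fun f hf =>
      (hpt f hf).trans ((time_le_delayedArrival δ D e).trans hτ)
    by_cases hs : e.dst = s
    · rw [hs]
      exact ⟨[], ⟨⟨by simp, by simp, by simp, by simp⟩, by simp⟩, by simp⟩
    · by_cases hmem : e.dst ∈ p.map TimeArc.dst
      · obtain ⟨f, hf, hfe⟩ := List.mem_map.1 hmem
        obtain ⟨p₁, p₂, rfl⟩ := List.append_of_mem hf
        refine ⟨p₁ ++ [f], hfe ▸ hp.of_append, fun g hg => hpt' g ?_⟩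
        simp only [List.mem_append, List.mem_cons] at hg ⊢
        tauto
      · refine ⟨p ++ [e], ⟨⟨?_, ?_, by simp, ?_⟩, ?_⟩, ?_⟩
        · intro g hg
          rcases List.mem_append.1 hg with hg | hg
          · exact hp.mem_arcs g hg
          · rwa [List.mem_singleton.1 hg]
        · intro g hg
          cases p with
          | nil =>
            have h1 := hp.finish
            simp only [List.nil_append, List.head?_cons, Option.mem_def, Option.some.injEq] at hg
            simp only [List.getLast?_nil, Option.map_none, Option.getD_none] at h1
            rw [← hg, h1]
          | cons a p => exact hp.start g (by simpa using hg)
        · rw [List.isChain_append]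
          refine ⟨hp.chain, by simp, ?_⟩
          intro x hx y hy
          simp only [List.head?_cons, Option.mem_def, Option.some.injEq] at hy
          subst hy
          have h1 := hp.finish
          rw [Option.mem_def] at hx
          rw [hx] at h1
          exact ⟨h1, hpt x (List.mem_of_getLast? hx)⟩
        · have hn := hp.nodup
          rw [List.map_append, List.map_singleton, ← List.cons_append]
          refine List.Nodup.append hn (by simp) ?_
          simp only [List.disjoint_singleton, List.mem_cons, not_or]
          exact ⟨hs, hmem⟩
        · intro g hg
          rcases List.mem_append.1 hg with hg | hg
          · exact hpt' g hg
          · rwa [List.mem_singleton.1 hg]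

/-! ### Encodings -/

theorem getD_flatMap_encode {n : ℕ} (L : List (TimeArc (Fin n))) (i : ℕ) (hi : i < L.length)
    (k : ℕ) (hk : k < 4) :
    (L.flatMap TimeArc.encode).getD (4 * i + k) 0 = (L[i].encode).getD k 0 := by
  induction L generalizing i with
  | nil => simp at hi
  | cons e L ih =>
    have hlen : e.encode.length = 4 := rfl
    cases i with
    | zero =>
      rw [List.flatMap_cons, List.getD_append _ _ _ _ (by rw [hlen]; omega)]
      simp
    | succ i =>
      rw [List.flatMap_cons, List.getD_append_right _ _ _ _ (by rw [hlen]; omega), hlen,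
        show 4 * (i + 1) + k - 4 = 4 * i + k by omega, ih i (by simpa using hi)]
      simp

/-- The words of the encoding of an instance with the time arcs `L`. -/
structure Words (I : DRCInstance) (L : List (TimeArc (Fin I.n))) (w : ℕ → ℕ) : Prop where
  nodup : L.Nodup
  arcs : L.toFinset = I.graph.arcs
  card : w 1 = L.length
  s : w 2 = I.s
  z : w 3 = I.z
  x : w 4 = I.x
  δ : w 5 = I.δ
  arc : ∀ i (hi : i < L.length), w (6 + 4 * i) = L[i].src ∧ w (6 + 4 * i + 1) = L[i].dst ∧
    w (6 + 4 * i + 2) = L[i].time ∧ w (6 + 4 * i + 3) = L[i].trav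

theorem DRCInstance.IsEncoding.words {I : DRCInstance} {w : List ℕ} (h : I.IsEncoding w) :
    ∃ L : List (TimeArc (Fin I.n)), Words I L (fun i => w.getD i 0) ∧
      w.length = 6 + 4 * L.length ∧ L.length = I.graph.arcs.card := by
  obtain ⟨L, hL, harcs, rfl⟩ := h
  have hcard : L.length = I.graph.arcs.card := by
    rw [← harcs, List.toFinset_card_of_nodup hL]
  have harc : ∀ i (hi : i < L.length), ∀ k < 4,
      ([I.n, I.graph.arcs.card, (I.s : ℕ), (I.z : ℕ), I.x, I.δ] ++
        L.flatMap TimeArc.encode).getD (6 + 4 * i + k) 0 = (L[i].encode).getD k 0 := by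
    intro i hi k hk
    rw [List.getD_append_right _ _ _ _ (by simp; omega), ← getD_flatMap_encode L i hi k hk]
    congr 1
    simp
    omega
  refine ⟨L, ⟨hL, harcs, by simp [hcard], by simp, by simp, by simp, by simp, fun i hi =>
    ⟨harc i hi 0 (by omega), harc i hi 1 (by omega), harc i hi 2 (by omega),
      harc i hi 3 (by omega)⟩⟩, ?_, hcard⟩
  have : ∀ L : List (TimeArc (Fin I.n)), (L.flatMap TimeArc.encode).length = 4 * L.length := by
    intro L
    induction L with
    | nil => rfl
    | cons e L ih =>
      rw [List.flatMap_cons, List.length_append, ih, List.length_cons]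
      simp only [TimeArc.encode, List.length_cons, List.length_nil]
      omega
  rw [List.length_append, this]
  simp

/-! ### Cuts and delays -/

namespace WordRAM

variable {I : DRCInstance} {L : List (TimeArc (Fin I.n))} {w M : ℕ → ℕ} {p₀ : ℕ}

/-- If some set of few delays disconnects `s` and `z`, then there is a small cut. -/
theorem exists_cut_of_not_isYes (hw : Words I L w) (hE : Events p₀ L.length w M) (hp : 3 < p₀)
    (hno : ¬ I.IsYes) : ∃ S, IsCut p₀ (3 * L.length + 1) (M 3) M S ∧
      cutCap p₀ (3 * L.length + 1) M S ≤ min I.x L.length := by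
  classical
  simp only [DRCInstance.IsYes, not_forall] at hno
  obtain ⟨D, hD, hx, hno⟩ := hno
  have hDL : D.card ≤ L.length := by
    refine (Finset.card_le_card hD).trans ?_
    rw [← hw.arcs]
    exact List.toFinset_card_le L
  -- The events that can be attended when `D` is delayed. Halving the key recovers the time, for the
  -- odd keys of departures too.
  refine ⟨{p | ∃ v, M (p + 15) = (v : Fin I.n).val ∧
    Arrives I.graph I.δ D I.s v (M (p + 13) / 2)}, ⟨?_, ?_⟩, ?_⟩
  · exact ⟨I.s, hE.source_vertex.trans hw.s, .start _⟩
  · rintro p - ⟨v, hv, h⟩ hz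
    rw [hv, hE.input 3 hp, hw.z] at hz
    obtain ⟨q, hq, -⟩ := h.exists_path
    exact hno ⟨q, Fin.ext hz ▸ hq⟩
  · have harcs : ∀ i (hi : i < L.length), L[i] ∈ I.graph.arcs := fun i hi => by
      rw [← hw.arcs]
      simp
    let J : Finset ℕ := {i ∈ Finset.range L.length | ∃ h : i < L.length, L[i] ∈ D}
    have hJ : J.card ≤ D.card := by
      -- The default arc is never reached, since `J` contains only valid indices. Injectivity holds
      -- because the input lists no arc twice.
      refine Finset.card_le_card_of_injOn (fun i => if h : i < L.length then L[i] else ⟨I.s, I.s, 0, 0⟩)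
        ?_ ?_
      · intro i hi
        obtain ⟨-, h, hi⟩ := Finset.mem_filter.1 hi
        simpa [h] using hi
      · intro i hi j hj hij
        obtain ⟨-, h, hi⟩ := Finset.mem_filter.1 hi
        obtain ⟨-, h', hj⟩ := Finset.mem_filter.1 hj
        simp only [h, h', dif_pos] at hij
        exact (hw.nodup.getElem_inj_iff).1 hij
    refine (hE.cutCap_le_card (J := J) ?_ ?_ ?_).trans (hJ.trans (le_min hx hDL))
    · rintro p r - - ⟨h1, h2⟩ ⟨v, hv, h⟩
      refine ⟨v, h1 ▸ hv, h.mono (Nat.div_le_div_right ?_)⟩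
      unfold Before at h2
      omega
    · rintro i hi ⟨v, hv, h⟩
      rw [(hE.vertex i hi).2.2, (hw.arc i hi).1] at hv
      obtain rfl := Fin.ext hv
      refine ⟨L[i].dst, (hE.vertex i hi).2.1.trans (hw.arc i hi).2.1, .step _ _ (harcs i hi)
        (h.mono ?_) ?_⟩
      · rw [(hE.key i hi).2.2, (hw.arc i hi).2.2.1]
        omega
      · rw [(hE.key i hi).2.1, (hw.arc i hi).2.2.1, (hw.arc i hi).2.2.2, hw.δ, delayedArrival]
        split_ifs <;> omega
    · rintro i hi ⟨v, hv, h⟩ hnot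
      rw [(hE.vertex i hi).2.2, (hw.arc i hi).1] at hv
      obtain rfl := Fin.ext hv
      refine Finset.mem_filter.2 ⟨Finset.mem_range.2 hi, hi, ?_⟩
      by_contra hiD
      refine hnot ⟨L[i].dst, (hE.vertex i hi).1.trans (hw.arc i hi).2.1, .step _ _ (harcs i hi)
        (h.mono ?_) ?_⟩
      · rw [(hE.key i hi).2.2, (hw.arc i hi).2.2.1]
        omega
      · rw [(hE.key i hi).1, (hw.arc i hi).2.2.1, (hw.arc i hi).2.2.2, delayedArrival, if_neg hiD]
        omega

/-- If there is a small cut, then some set of few delays disconnects `s` and `z`. -/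
theorem not_isYes_of_cut (hw : Words I L w) (hE : Events p₀ L.length w M) (hp : 3 < p₀) {S : Set ℕ}
    (hS : IsCut p₀ (3 * L.length + 1) (M 3) M S)
    (hc : cutCap p₀ (3 * L.length + 1) M S ≤ min I.x L.length) : ¬ I.IsYes := by
  classical
  obtain ⟨hlater, hdel⟩ := hE.of_cutCap_le (hc.trans (min_le_right _ _))
  let J : Finset ℕ := {i ∈ Finset.range L.length |
    p₀ + 48 + 48 * i ∈ S ∧ p₀ + 16 + 48 * i ∉ S}
  let arc : ℕ → TimeArc (Fin I.n) := fun i => if h : i < L.length then L[i] else ⟨I.s, I.s, 0, 0⟩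
  have harc : ∀ i (h : i < L.length), arc i = L[i] := fun i h => dif_pos h
  have hDcard : (J.image arc).card ≤ I.x :=
    Finset.card_image_le.trans ((hE.card_le_cutCap S).trans (hc.trans (min_le_left _ _)))
  have hDsub : J.image arc ⊆ I.graph.arcs := by
    intro e he
    obtain ⟨i, hi, rfl⟩ := Finset.mem_image.1 he
    have hi' := Finset.mem_range.1 (Finset.mem_filter.1 hi).1
    rw [harc i hi', ← hw.arcs]
    simp
  intro hyes
  obtain ⟨q, hq⟩ := hyes _ hDsub hDcard
  -- A walk that starts from an event in `S` ends at the vertex of an event in `S`. Waiting leads to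
  -- the departure of the next arc. If that arc is delayed, its delayed arrival is in `S` by
  -- closure; otherwise its unit edge is not cut and the punctual arrival is in `S`.
  have key : ∀ (q : List (TimeArc (Fin I.n))) (v : Fin I.n) (p : ℕ),
      IsNode p₀ (3 * L.length + 1) p → p ∈ S → M (p + 15) = v →
      (∀ e ∈ q.head?, e.src = v ∧ M (p + 13) ≤ 2 * e.time) → (∀ e ∈ q, e ∈ I.graph.arcs) →
      (q.IsChain fun e f => e.dst = f.src ∧ delayedArrival I.δ (J.image arc) e ≤ f.time) →
      ∃ r, IsNode p₀ (3 * L.length + 1) r ∧ r ∈ S ∧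
        M (r + 15) = ((q.getLast?.map TimeArc.dst).getD v : Fin I.n) := by
    intro q
    induction q with
    | nil => exact fun v p hp hpS hv _ _ _ => ⟨p, hp, hpS, by simpa using hv⟩
    | cons e q ih =>
      intro v p hp hpS hv hhead harcs hchain
      obtain ⟨rfl, ht⟩ := hhead e (by simp)
      have heL : e ∈ L := by
        have := harcs e (by simp)
        rwa [← hw.arcs, List.mem_toFinset] at this
      obtain ⟨i, hi, rfl⟩ := List.getElem_of_mem heL
      obtain ⟨n1, n2, n3⟩ := isNode_event (p₀ := p₀) hi
      have w1 := hw.arc i hi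
      have k1 := hE.key i hi
      have v1 := hE.vertex i hi
      have hdep : p₀ + 48 + 48 * i ∈ S := by
        refine hlater p _ hp n3 ⟨?_, Or.inl ?_⟩ hpS
        · rw [hv, v1.2.2, w1.1]
        · rw [k1.2.2, w1.2.2.1]
          omega
      have harr : ∃ r, IsNode p₀ (3 * L.length + 1) r ∧ r ∈ S ∧ M (r + 15) = L[i].dst ∧
          M (r + 13) = 2 * delayedArrival I.δ (J.image arc) L[i] := by
        by_cases hiD : L[i] ∈ J.image arc
        · refine ⟨_, n2, hdel i hi hdep, v1.2.1.trans w1.2.1, ?_⟩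
          rw [k1.2.1, delayedArrival, if_pos hiD, w1.2.2.1, w1.2.2.2, hw.δ]
          ring
        · refine ⟨_, n1, ?_, v1.1.trans w1.2.1, ?_⟩
          · by_contra hnot
            exact hiD (Finset.mem_image.2 ⟨i, Finset.mem_filter.2
              ⟨Finset.mem_range.2 hi, hdep, hnot⟩, harc i hi⟩)
          · rw [k1.1, delayedArrival, if_neg hiD, w1.2.2.1, w1.2.2.2]
            ring
      obtain ⟨r, hr, hrS, hrv, hrk⟩ := harr
      obtain ⟨h1, h2⟩ := List.isChain_cons.1 hchain
      obtain ⟨r', g1, g2, g3⟩ := ih L[i].dst r hr hrS hrv (fun f hf => ⟨(h1 f hf).1.symm, by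
        have := (h1 f hf).2
        omega⟩) (fun f hf => harcs f (by simp [hf])) h2
      refine ⟨r', g1, g2, ?_⟩
      rw [g3, List.getLast?_cons]
      cases q.getLast? <;> simp
  obtain ⟨r, h1, h2, h3⟩ := key q I.s p₀ (isNode_source p₀ _) hS.source
    (hE.source_vertex.trans hw.s) (fun e he => ⟨hq.start e he, by rw [hE.source_key]; omega⟩)
    hq.mem_arcs hq.chain
  refine hS.target r h1 h2 ?_
  rw [h3, hq.finish, hE.input 3 hp, hw.z]

/-! ### The program -/

/-- The program for Delay-Robust Connection. -/
def delayRobustConnection : Prog :=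
  .seq writeRecords <| .seq link <|
  .seq (.seq (.assign 0 (.lit 1))
    -- At most `m` arcs can be delayed, so capping `x` at `m` changes nothing but bounds the rounds
    -- in terms of `m`. The extra round decides whether the cuts exceed the cap.
    (.assign 1 (.add (.inf (.load (.lit 4)) (.load (.lit 1))) (.lit 1)))) maxFlow

theorem delayRobustConnection_spec {W b B m : ℕ} {σ : State} (hs : Sizes W b) (hσ : Bounded b σ)
    (hw : Words I L w) (hwB : ∀ a, w a ≤ B) (hm : L.length = m) (hmB : 4 * m + 6 ≤ B)
    (hB : 100 * B + 100 ≤ b) (hmem : σ.mem = w)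
    (hw0 : ∀ a, 16 * (m + 1) ≤ a → w a = 0) :
    Run W b delayRobustConnection (40000 * (m ^ 2 + 1)) σ fun τ =>
      (I.IsYes → τ.reg 0 = 1) ∧ (¬ I.IsYes → τ.reg 0 = 0) := by
  have hcard := hw.card.trans hm
  obtain ⟨p₀, hp⟩ : ∃ p₀, p₀ = 16 * (m + 1) := ⟨_, rfl⟩
  have hq : min I.x m + 1 ≤ m + 1 := by omega
  -- Linking is quadratic, and so are at most `m + 1` flow rounds of linear cost; writing the
  -- records is linear.
  refine Run.mono (Run.seq (T' := ((3 * m + 1) * (500 * m + 602) + 20) + (100 +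
    ((min I.x m + 1) * (1200 * (3 * m + 1) + 302) + 2)))
    (writeRecords_spec hs hσ hwB hcard hp (by omega) (by omega) hmem
    (hp ▸ hw0)) ?_) ?_ fun _ _ h => h
  · rintro τ hτ ⟨hsrc, hR⟩
    refine Run.seq (link_spec hs hτ hp (by omega) ((hR.input 1 (by omega)).trans hcard) hsrc
      hR.linked) ?_
    rintro υ hυ ⟨hsrc, hL⟩
    have hE := hL.events hR hp hcard
    have h4 : υ.mem 4 = I.x := (hE.input 4 (by omega)).trans hw.x
    have h1 : υ.mem 1 = m := (hE.input 1 (by omega)).trans hcard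
    refine Run.seq (Run.mono (Run.of_wp hs (by decide) hυ
      (Q := fun τ => Flow p₀ (3 * m + 1) (m + 1) (min I.x m + 1) υ.mem (min I.x m + 1) τ) ?_)
      (by decide) fun _ _ h => h) ?_
    · simp only [wp, Expr.eval, Expr.eval_inf, h1, h4]
      exact ⟨by omega, by omega, rfl, rfl, le_rfl, hsrc, hE.net, fun _ _ => rfl,
        fun p hp => Or.inl (hE.mark p hp), fun S _ => by simp⟩
    · intro ρ hρ hF
      refine Run.mono (maxFlow_spec hs (by omega) (by omega) (by omega) hρ hF) le_rfl ?_
      subst hm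
      rintro ρ' - (⟨h1, h2⟩ | ⟨h1, S, h2, h3⟩)
      · refine ⟨fun _ => h1, fun hno => ?_⟩
        obtain ⟨S, hS, hc⟩ := exists_cut_of_not_isYes hw hE (by omega) hno
        have := h2 S hS
        omega
      · exact ⟨fun hyes => absurd hyes (not_isYes_of_cut hw hE (by omega) h2 (by omega)),
          fun _ => h1⟩
  · have h5 : (min I.x m + 1) * (1200 * (3 * m + 1) + 302) ≤
        (m + 1) * (1200 * (3 * m + 1) + 302) := Nat.mul_le_mul_right _ hq
    nlinarith [sq_nonneg (m - 1 : ℤ), Nat.le_self_pow (two_ne_zero) m]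

end WordRAM

/-- Delay-Robust Connection can be solved in time `O(|E| ^ 2)`: one fixed program solves all
instances, with an absolute constant `C` (the summand `1` only matters for `E = ∅`). -/
theorem mainTheorem1 :
    ∃ (P : WordRAM.Prog) (C k : ℕ),
      WordRAM.Solves DRCInstance.IsEncoding DRCInstance.IsYes
        (fun I => C * (I.graph.arcs.card ^ 2 + 1)) k P := by
  refine ⟨WordRAM.delayRobustConnection, 40000, 6, fun I w hw B hlen hB => ?_⟩
  obtain ⟨L, hL, hlenL, hcard⟩ := hw.words
  have hwB : ∀ a, w.getD a 0 ≤ B := by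
    intro a
    rcases lt_or_ge a w.length with h | h
    · rw [List.getD_eq_getElem _ _ h]
      exact hB _ (List.getElem_mem h)
    · rw [List.getD_eq_default _ _ h]
      exact Nat.zero_le _
  -- Contents stay below `b = 100 * B + 100`, and words must exceed `100 * b`. The input has at
  -- least six words, so `B + 2 ≥ 8`, and `8 ^ 5 = 32768` beats the factor `10000`; hence the
  -- exponent 6.
  have hW : 32768 * (B + 2) ≤ (B + 2) ^ 6 := by
    have h1 : 8 ^ 5 ≤ (B + 2) ^ 5 := Nat.pow_le_pow_left (by omega) 5
    calc 32768 * (B + 2) ≤ (B + 2) ^ 5 * (B + 2) := Nat.mul_le_mul_right _ h1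
      _ = (B + 2) ^ 6 := (pow_succ _ _).symm
  obtain ⟨τ, t, h1, h2, -, h3⟩ := WordRAM.delayRobustConnection_spec (W := (B + 2) ^ 6)
    (b := 100 * B + 100) (σ := WordRAM.init w) ⟨by omega, by omega⟩
    ⟨fun _ => Nat.zero_le _, fun a => (hwB a).trans (by omega)⟩ hL hwB rfl (by omega) le_rfl rfl
    (fun a ha => List.getD_eq_default _ _ (by omega))
  exact ⟨τ, t, h1, h2.trans_eq (by rw [hcard]), h3⟩
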